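/- There is a universal constant $c>0$ with the following property. Fix $\eta>1$ and integers $S,A\ge 2$, and let $(\epsilon_n)_{n\ge 0}$ be positive reals with $\epsilon_n\to 0$. Then for all sufficiently large $n$ (how large may depend on $\eta,S,A$ and the sequence), all $H\ge 2$, all $T\ge 0$ and every learning algorithm that observes $T$ episodes of length $H$: if $\mathbb{E}_\Phi\big[\tfrac1H\big(V^\star(r)-V^{\hat\pi(r)}(r)\big)\big]\le \epsilon_n$ for every Block MDP $\Phi\in\mathcal{C}_n$ and every reward function $r$ with $r_h(x,a)\in[0,1]$, then $$TH\;\ge\; c\left(n\log\frac1{\epsilon_n}+\frac{SA}{\epsilon_n^2}\right).$$ Here a Block MDP $\Phi=(p,q,f)$ has $S$ latent states, $n$ contexts, $A$ actions, latent transition probabilities $p(s'|s,a)$, a decoding function $f$ from contexts to latent states, emission distributions $q(\cdot|s)$ with support $f^{-1}(s)$, and context transition kernel $P(y|x,a)=q(y|f(y))\,p(f(y)|f(x),a)$. The algorithm is given $r$ at the start. It explores adaptively and possibly at random: the action in each round is drawn from a distribution that depends on $r$, all earlier contexts and actions, and the current context. After $T$ episodes it outputs a (possibly random) policy $\hat\pi(r)=(\hat\pi_h(\cdot|x))_{h\le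 H}$. $V^\pi(r)=\mathbb{E}_\Phi[\sum_{h=1}^H r_h(x_h^\pi,a_h^\pi)]$ and $V^\star(r)=\sup_\pi V^\pi(r)$. The class $\mathcal{C}_n$ consists of the Block MDPs such that (1) the cluster proportions $\alpha_s=|f^{-1}(s)|/n$ are positive, with $\alpha_{s_1}\le\eta\,\alpha_{s_2}$ for all $s_1,s_2$; (2) $p(s_2|s_1,a)\le\eta\,p(s_3|s_1,a)$ and $p(s_1|s_2,a)\le\eta\,p(s_1|s_3,a)$ for all $a,s_1,s_2,s_3$, and $q(x|s)\le\eta\,q(y|s)$ for all $s$ and $x,y\in f^{-1}(s)$; (3) the initial context is uniform; (4) $I(\Phi)>0$, i.e. $I(x;\Phi)>0$ for every context $x$ and every behavior policy $\pi$ with $\pi_h(a_1|x)\le\eta\,\pi_h(a_2|y)$ for all $h,x,y,a_1,a_2$. Here $I(x;\Phi)=\min_{j\ne f(x)}\inf_{c'>0}I_j(x;c',\Phi)$ and, with $i=f(x)$ and $u=c'q(x|i)$, $$I_j(x;c',\Phi)=n\sum_{a,s}\Big\{u\,p(j|s,a)\,m(s,a)\log\tfrac{c'p(j|s,a)}{p(i|s,a)}+u\,m(j,a)\,p(s|j,a)\log\tfrac{p(s|j,a)}{p(s|i,a)}+\big(1-u\,p(j|s,a)\big)m(s,a)\log\tfrac{1-u\,p(j|s,a)}{1-q(x|i)\,p(i|s,a)}\Big\}.$$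 In this formula $m(s,a)=\frac1{H-1}\sum_{h=1}^{H-1}\mathbb{P}_\Psi[g(x_h)=s,a_h=a]$ under $\pi$ in the model $\Psi=(p,\tilde q,g)$, where $g(x)=j$ and $g=f$ elsewhere; $\tilde q(x|j)=u$; $\tilde q(y|j)=(1-u)q(y|j)$ for $y\in f^{-1}(j)$; $\tilde q(y|i)=q(y|i)/(1-q(x|i))$ for $y\in f^{-1}(i)\setminus\{x\}$; and $\tilde q(\cdot|s)=q(\cdot|s)$ for $s\ne i,j$. We set $I_j(x;c',\Phi)=\infty$ if $\Psi$ is not a Block MDP. -/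

import Mathlib

open Filter Topology MeasureTheory

noncomputable section

namespace BlockMDP

/-- Data of a block MDP with latent states `Fin S`, contexts `Fin n`, actions `Fin A`:
initial context distribution `μ`, latent transition probabilities `p s a s' = p(s' | s, a)`,
emission probabilities `q s x = q(x | s)` and decoding function `f`. The laws these data have to
satisfy are collected in `BMDP.WellDefined`. -/
structure BMDP (S n A : ℕ) where
  μ : Fin n → ℝ
  p : Fin S → Fin A → Fin S → ℝ
  q : Fin S → Fin n → ℝ
  f : Fin n → Fin S

/-- The data form a block MDP: `μ`, `p(· | s, a)` and `q(· | s)` are probability vectors, and the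
support of `q(· | s)` is the cluster `f⁻¹(s)`. -/
structure BMDP.WellDefined {S n A : ℕ} (Φ : BMDP S n A) : Prop where
  μ_mem : Φ.μ ∈ stdSimplex ℝ (Fin n)
  p_mem : ∀ s a, Φ.p s a ∈ stdSimplex ℝ (Fin S)
  q_mem : ∀ s, Φ.q s ∈ stdSimplex ℝ (Fin n)
  q_support : ∀ s, Function.support (Φ.q s) = Φ.f ⁻¹' {s}

/-- The context transition kernel `P(y | x, a) = q(y | f(y)) p(f(y) | f(x), a)`. -/
def BMDP.ker {S n A : ℕ} (Φ : BMDP S n A) (x : Fin n) (a : Fin A) (y : Fin n) : ℝ :=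
  Φ.q (Φ.f y) y * Φ.p (Φ.f x) a (Φ.f y)

/-- Cluster proportions `α_s = |f⁻¹(s)| / n`. -/
def BMDP.alpha {S n A : ℕ} (Φ : BMDP S n A) (s : Fin S) : ℝ :=
  ((Finset.univ.filter fun x => Φ.f x = s).card : ℝ) / n

/-- `η`-regularity of the model: all ratios of cluster proportions, of latent transition
probabilities out of a state, of latent transition probabilities into a state, and of emission
probabilities within a cluster are at most `η`. All `α_s` are positive. -/
structure BMDP.Regular {S n A : ℕ} (η : ℝ) (Φ : BMDP S n A) : Prop where
  alpha_pos : ∀ s, 0 < Φ.alpha s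
  alpha_le : ∀ s₁ s₂, Φ.alpha s₁ ≤ η * Φ.alpha s₂
  p_out_le : ∀ a s₁ s₂ s₃, Φ.p s₁ a s₂ ≤ η * Φ.p s₁ a s₃
  p_in_le : ∀ a s₁ s₂ s₃, Φ.p s₂ a s₁ ≤ η * Φ.p s₃ a s₁
  q_le : ∀ s x y, Φ.f x = s → Φ.f y = s → Φ.q s x ≤ η * Φ.q s y

/-- The initial context is uniform. -/
def BMDP.UniformStart {S n A : ℕ} (Φ : BMDP S n A) : Prop :=
  ∀ x, Φ.μ x = 1 / (n : ℝ)

/-- Policies over an episode of `H` rounds: `π h x a = π_h(a | x)`. -/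
abbrev Policy (n A H : ℕ) : Type :=
  {π : Fin H → Fin n → Fin A → ℝ // ∀ h x, π h x ∈ stdSimplex ℝ (Fin A)}

/-- `η`-regularity of a behavior policy. -/
def Policy.Regular {n A H : ℕ} (η : ℝ) (π : Policy n A H) : Prop :=
  ∀ h x y a₁ a₂, π.1 h x a₁ ≤ η * π.1 h y a₂

/-- Law of the context observed after `k` transitions (so in round `k + 1` of the episode) when
policy `π` is run in `Φ`. -/
def BMDP.ctxLaw {S n A H : ℕ} (Φ : BMDP S n A) (π : Policy n A H) : ℕ → Fin n → ℝ
  | 0 => Φ.μ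
  | k + 1 => fun y =>
      if hk : k < H then
        ∑ x, ∑ a, Φ.ctxLaw π k x * π.1 ⟨k, hk⟩ x a * Φ.ker x a y
      else 0

/-- Reward functions `r h x a = r_h(x, a)`. -/
abbrev Reward (n A H : ℕ) : Type := Fin H → Fin n → Fin A → ℝ

/-- The value `V^π(r) = E_Φ[∑_h r_h(x_h, a_h)]` of a policy. -/
def BMDP.value {S n A H : ℕ} (Φ : BMDP S n A) (r : Reward n A H) (π : Policy n A H) : ℝ :=
  ∑ h : Fin H, ∑ x, ∑ a, Φ.ctxLaw π h x * π.1 h x a * r h x a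

/-- The optimal value `V^⋆(r)`. -/
def BMDP.optValue {S n A H : ℕ} (Φ : BMDP S n A) (r : Reward n A H) : ℝ :=
  ⨆ π : Policy n A H, Φ.value r π

/-! ### The rate function -/

/-- The model `Ψ_j` obtained from `Φ` by moving the context `x` from its cluster `i = f(x)` to the
cluster `j ≠ i`, with emission probability `c q(x | i)` there. -/
def BMDP.confusing {S n A : ℕ} (Φ : BMDP S n A) (x : Fin n) (j : Fin S) (c : ℝ) : BMDP S n A where
  μ := Φ.μ
  p := Φ.p
  f := Function.update Φ.f x j
  q := fun s y =>
    if s = Φ.f x then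
      if y = x then 0 else Φ.q s y / (1 - Φ.q s x)
    else if s = j then
      if y = x then c * Φ.q (Φ.f x) x else (1 - c * Φ.q (Φ.f x) x) * Φ.q s y
    else Φ.q s y

/-- `m_π(s, a)`: expected proportion of the first `H - 1` rounds spent in the pair
(latent state `s`, action `a`) when `π` is run in `Φ`. -/
def BMDP.occupation {S n A H : ℕ} (Φ : BMDP S n A) (π : Policy n A H) (s : Fin S) (a : Fin A) : ℝ :=
  1 / ((H : ℝ) - 1) *
    ∑ h : Fin H, if (h : ℕ) + 1 < H then
      ∑ x, (if Φ.f x = s then Φ.ctxLaw π h x * π.1 h x a else 0)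
    else 0

open Classical in
/-- The divergence `I_j(x; c, Φ)` between `Ψ_j` and `Φ` under the behavior policy `π`; it is `∞`
when `Ψ_j` is not a block MDP. -/
def BMDP.rateAt {S n A H : ℕ} (Φ : BMDP S n A) (π : Policy n A H) (x : Fin n) (j : Fin S)
    (c : ℝ) : EReal :=
  if (Φ.confusing x j c).WellDefined then
    (((n : ℝ) * ∑ a, ∑ s,
      (c * Φ.q (Φ.f x) x * Φ.p s a j * (Φ.confusing x j c).occupation π s a
          * Real.log (c * Φ.p s a j / Φ.p s a (Φ.f x))
        + c * Φ.q (Φ.f x) x * (Φ.confusing x j c).occupation π j a * Φ.p j a s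
          * Real.log (Φ.p j a s / Φ.p (Φ.f x) a s)
        + (1 - c * Φ.q (Φ.f x) x * Φ.p s a j) * (Φ.confusing x j c).occupation π s a
          * Real.log ((1 - c * Φ.q (Φ.f x) x * Φ.p s a j)
              / (1 - Φ.q (Φ.f x) x * Φ.p s a (Φ.f x)))) : ℝ) : EReal)
  else ⊤

/-- The rate function `I(x; Φ) = min_{j ≠ f(x)} inf_{c > 0} I_j(x; c, Φ)` under the behavior
policy `π`. -/
def BMDP.rate {S n A H : ℕ} (Φ : BMDP S n A) (π : Policy n A H) (x : Fin n) : EReal :=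
  ⨅ (j : Fin S) (_ : j ≠ Φ.f x) (c : ℝ) (_ : 0 < c), Φ.rateAt π x j c

/-- Separability `I(Φ) > 0`: the rate `I(x; Φ)` is positive for every context `x`, for episodes
of `H` rounds generated by any `η`-regular behavior policy. -/
def BMDP.Separable {S n A : ℕ} (H : ℕ) (η : ℝ) (Φ : BMDP S n A) : Prop :=
  ∀ π : Policy n A H, π.Regular η → ∀ x, 0 < Φ.rate π x

/-! ### Learning algorithms -/

/-- Observations of `T` episodes: `d t h` is the (context, action) pair of round `h` of
episode `t`. -/
abbrev Data (n A H T : ℕ) : Type := Fin T → Fin H → Fin n × Fin A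

/-- A learning algorithm in the reward-specific setting, with adaptive (and randomized)
exploration over `T` episodes of `H` rounds. It knows the reward function `r` from the start.
`explore r t h d` is the distribution of the action played in round `h` of episode `t`; it depends
only on the observations made before that round and on the current context. After the `T` episodes
the algorithm outputs a policy, drawn from `output r d`. -/
structure Algorithm (n A H T : ℕ) where
  explore : Reward n A H → Fin T → Fin H → Data n A H T → Fin A → ℝ
  explore_mem : ∀ r t h d, explore r t h d ∈ stdSimplex ℝ (Fin A)
  explore_adapted : ∀ r t h (d d' : Data n A H T),
    (∀ t' h', (t' < t ∨ (t' = t ∧ h' < h)) → d t' h' = d' t' h') →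
    (d t h).1 = (d' t h).1 → explore r t h d = explore r t h d'
  output : Reward n A H → Data n A H T → Measure (Policy n A H)
  output_prob : ∀ r d, IsProbabilityMeasure (output r d)

/-- Contribution of the environment to the likelihood of an episode:
`μ(x_1) ∏_{h < H} P(x_{h+1} | x_h, a_h)`. -/
def BMDP.episodeLik {S n A H : ℕ} (Φ : BMDP S n A) (τ : Fin H → Fin n × Fin A) : ℝ :=
  ∏ h : Fin H,
    (if (h : ℕ) = 0 then Φ.μ (τ h).1 else 1) *
    (if hh : (h : ℕ) + 1 < H then Φ.ker (τ h).1 (τ h).2 (τ ⟨h + 1, hh⟩).1 else 1)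

/-- The probability that the algorithm, run in `Φ` with reward `r`, observes the data `d`. -/
def Algorithm.dataProb {S n A H T : ℕ} (alg : Algorithm n A H T) (Φ : BMDP S n A)
    (r : Reward n A H) (d : Data n A H T) : ℝ :=
  ∏ t : Fin T, (Φ.episodeLik (d t) * ∏ h : Fin H, alg.explore r t h d (d t h).2)

/-- The expected normalized suboptimality `E_Φ[(V^⋆(r) - V^{π̂(r)}(r)) / H]`. -/
def Algorithm.expectedLoss {S n A H T : ℕ} (alg : Algorithm n A H T) (Φ : BMDP S n A)
    (r : Reward n A H) : ℝ :=
  ∑ d : Data n A H T, alg.dataProb Φ r d *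
    ∫ π, (1 / (H : ℝ)) * (Φ.optValue r - Φ.value r π) ∂(alg.output r d)

/-- The guarantee: expected normalized suboptimality at most `ε` for every `η`-regular block MDP
with `S` latent states, uniform initial context and positive rate, and for every reward function
with values in `[0, 1]`. -/
def Algorithm.Guarantee {n A H T : ℕ} (alg : Algorithm n A H T) (S : ℕ) (η ε : ℝ) : Prop :=
  ∀ Φ : BMDP S n A, Φ.WellDefined → Φ.Regular η → Φ.UniformStart → Φ.Separable H η →
    ∀ r : Reward n A H, (∀ h x a, r h x a ∈ Set.Icc (0 : ℝ) 1) → alg.expectedLoss Φ r ≤ ε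

end BlockMDP

end

/-! The two terms come from two separate difficulties: finding the best action of every latent
state, and finding the latent state of most contexts. Each is isolated in a subfamily of the class,
and adding the two bounds costs only a constant.

All hard instances are `tiltedModel`s: the next context has the nearly uniform law `(1/n)(1 + δ(f x,
a)(b(f y) - mean b))`, with a 0/1 label `b`. The kernel is affine in the scalar tilt, so the law of
the next context depends on the past only through the mean tilt, and for a reward on contexts the
value is affine in the mean tilts (`TiltBounds.value_eq`). There is no trade-off between rounds: the
optimum plays the action of tilt `Δ` everywhere. Every context keeps probability at least `1/(2n)`,
so the regret is at least of order `Δ`, times the covariance of label and reward, times the average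
probability of a wrong action (`TiltBounds.regret_ge`, `TiltBounds.expectedLoss_ge`).

Actions (`action_sample_bound`): the labels are fixed, `Δ = 512 ε`, and the best actions are
arbitrary. A small loss forces the output to be mostly right. Playing action `a` in state `s` gives
information of order `Δ²` on whether `a` is best there, a round meets `s` with probability of order
`1/S`, and the `A` candidates share these visits; hence `SA/ε²`.

Contexts (`context_sample_bound`): `Δ` depends on `η` only, and in about half of the blocks of `S`
contexts the labels of two contexts may be exchanged. Exchanging one pair affects transitions only
out of the pair or into it, so the divergence of the data laws is at most `12TN/n`, where `N = H -
1`. By Bretagnolle–Huber the average error on a pair is at least of order `exp(-12TN/n)`, and a loss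
below `ε` forces `TN` to be of order `n log(1/ε)`.

Information is counted by the chain rule `Algorithm.kl_le`. Membership in the class rests on
`BMDP.separable_of_rows_ne`: the rate dominates squared Hellinger distances, so distinct transition
rows suffice. -/

namespace BlockMDP

/-! ### Sums of products of adapted kernels over finite sequences. -/

section Sequential

variable {ι Ω : Type*} [Fintype ι] [Fintype Ω]

/-- The involution `(d, ω) ↦ (update d i ω, d i)` turns the left side into a sum in which the second
component is free. -/
theorem sum_sum_update [DecidableEq ι] (i : ι) (F : (ι → Ω) → ℝ) :
    ∑ d : ι → Ω, ∑ ω, F (Function.update d i ω) = Fintype.card Ω * ∑ d, F d := by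
  rw [← Fintype.sum_prod_type' (f := fun d ω => F (Function.update d i ω))]
  let e : Equiv.Perm ((ι → Ω) × Ω) :=
    Function.Involutive.toPerm (fun z => (Function.update z.1 i z.2, z.1 i)) (by intro z; simp)
  calc _ = ∑ z, F (e z).1 := rfl
    _ = ∑ z : (ι → Ω) × Ω, F z.1 := Equiv.sum_comp e (fun z => F z.1)
    _ = _ := by rw [Fintype.sum_prod_type]; simp [Finset.mul_sum]

variable [LinearOrder ι]

/-- The final segment `U` is integrated out from its last coordinate backwards. The index type never
changes: an integrated coordinate stays as an idle summation variable, which accounts for one factor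
`card Ω`. -/
theorem card_pow_mul_sum_prod {κ : ι → (ι → Ω) → ℝ}
    (hκ : ∀ i d d', (∀ j ≤ i, d j = d' j) → κ i d = κ i d')
    (hsum : ∀ i d, ∑ ω, κ i (Function.update d i ω) = 1) (U : Finset ι) (g : (ι → Ω) → ℝ)
    (hU : ∀ i ∉ U, ∀ j ∈ U, i < j) (hg : ∀ d d', (∀ j ∉ U, d j = d' j) → g d = g d') :
    (Fintype.card Ω : ℝ) ^ U.card * ∑ d, (∏ i, κ i d) * g d
      = ∑ d, (∏ i ∈ Uᶜ, κ i d) * g d := by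
  induction U using Finset.induction_on_min with
  | empty => simp
  | insert a s has ih =>
    have ha : a ∉ s := fun h => lt_irrefl _ (has a h)
    have ih' := ih (fun i hi j hj => by
        by_cases h : i = a
        · exact h ▸ has j hj
        · exact hU i (by simp [h, hi]) j (by simp [hj]))
      (fun d d' h => hg d d' fun j hj => h j fun hjs => hj (by simp [hjs]))
    have hc : sᶜ = insert a (insert a s)ᶜ := by
      ext j; by_cases h : j = a <;> simp [h, ha]
    rw [Finset.card_insert_of_notMem ha, pow_succ', mul_assoc, ih', hc, ← sum_sum_update a]
    refine Finset.sum_congr rfl fun d _ => ?_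
    have key : ∀ ω, (∏ i ∈ insert a (insert a s)ᶜ, κ i (Function.update d a ω))
          * g (Function.update d a ω)
        = κ a (Function.update d a ω) * ((∏ i ∈ (insert a s)ᶜ, κ i d) * g d) := by
      intro ω
      rw [Finset.prod_insert (by simp), mul_assoc]
      congr 2
      · refine Finset.prod_congr rfl fun i hi => hκ _ _ _ fun j hj => ?_
        have : i < a := hU i (by simpa using hi) a (by simp)
        exact Function.update_of_ne (hj.trans_lt this).ne _ _
      · refine hg _ _ fun j hj => Function.update_of_ne ?_ _ _
        rintro rfl; simp at hj
    simp_rw [key, ← Finset.sum_mul, hsum, one_mul]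

theorem sum_prod_eq_one [Nonempty Ω] {κ : ι → (ι → Ω) → ℝ}
    (hκ : ∀ i d d', (∀ j ≤ i, d j = d' j) → κ i d = κ i d')
    (hsum : ∀ i d, ∑ ω, κ i (Function.update d i ω) = 1) :
    ∑ d, ∏ i, κ i d = 1 := by
  have h := card_pow_mul_sum_prod hκ hsum Finset.univ (fun _ => 1) (by simp) (by simp)
  simp only [mul_one, Finset.compl_univ, Finset.prod_empty, Finset.sum_const, Finset.card_univ,
    Fintype.card_fun, nsmul_eq_mul, Nat.cast_pow] at h
  have : (Fintype.card Ω : ℝ) ^ Fintype.card ι ≠ 0 := by simp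
  exact mul_left_cancel₀ this (by rw [h, mul_one])

/-- Integrating out the last coordinate on which `g` depends. -/
theorem sum_prod_mul_eq_step [Nonempty Ω] {κ : ι → (ι → Ω) → ℝ}
    (hκ : ∀ i d d', (∀ j ≤ i, d j = d' j) → κ i d = κ i d')
    (hsum : ∀ i d, ∑ ω, κ i (Function.update d i ω) = 1) (i : ι) (g : (ι → Ω) → ℝ)
    (hg : ∀ d d', (∀ j ≤ i, d j = d' j) → g d = g d') :
    ∑ d, (∏ i, κ i d) * g d
      = ∑ d, (∏ i, κ i d) * ∑ ω, κ i (Function.update d i ω) * g (Function.update d i ω) := by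
  set g' : (ι → Ω) → ℝ := fun d =>
    ∑ ω, κ i (Function.update d i ω) * g (Function.update d i ω) with hg'
  set U := Finset.univ.filter (fun j => i < j) with hU
  have hiU : i ∉ U := by simp [hU]
  have h1 := card_pow_mul_sum_prod hκ hsum U g
    (by intro j hj k hk; simp only [hU, Finset.mem_filter, Finset.mem_univ, true_and, not_lt] at *
        exact hj.trans_lt hk)
    (fun d d' h => hg d d' fun j hj => h j (by simpa [hU] using hj))
  -- `g'` no longer depends on coordinate `i`, so here `i` itself can join the final segment.
  have h2 := card_pow_mul_sum_prod hκ hsum (insert i U) g'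
    (by intro j hj k hk
        simp only [hU, Finset.mem_insert, Finset.mem_filter, Finset.mem_univ, true_and, not_lt,
          not_or] at *
        rcases hk with rfl | hk
        · exact lt_of_le_of_ne hj.2 hj.1
        · exact hj.2.trans_lt hk)
    (fun d d' h => by
      simp only [hg']
      have hagree : ∀ ω, ∀ j ≤ i, Function.update d i ω j = Function.update d' i ω j := by
        intro ω j hj
        rcases eq_or_ne j i with rfl | hne
        · simp
        · rw [Function.update_of_ne hne, Function.update_of_ne hne]
          exact h j (by simp [hU, hne, hj])
      exact Finset.sum_congr rfl fun ω _ => by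
        rw [hκ i _ _ (hagree ω), hg _ _ (hagree ω)])
  have hc : Uᶜ = insert i (insert i U)ᶜ := by
    ext j; by_cases h : j = i <;> simp [h, hiU]
  have h3 : (Fintype.card Ω : ℝ) * ∑ d, (∏ j ∈ Uᶜ, κ j d) * g d
      = ∑ d, (∏ j ∈ (insert i U)ᶜ, κ j d) * g' d := by
    rw [← sum_sum_update i]
    refine Finset.sum_congr rfl fun d _ => ?_
    rw [hg', Finset.mul_sum]
    refine Finset.sum_congr rfl fun ω _ => ?_
    rw [hc, Finset.prod_insert (by simp), mul_comm (κ i _), mul_assoc]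
    congr 1
    refine Finset.prod_congr rfl fun j hj => hκ _ _ _ fun k hk => ?_
    have hj' : j < i := by
      simp only [hU, Finset.mem_compl, Finset.mem_insert, Finset.mem_filter, Finset.mem_univ,
        true_and, not_or, not_lt] at hj
      exact lt_of_le_of_ne hj.2 hj.1
    exact Function.update_of_ne (hk.trans_lt hj').ne _ _
  rw [Finset.card_insert_of_notMem hiU, pow_succ'] at h2
  have : (Fintype.card Ω : ℝ) * (Fintype.card Ω : ℝ) ^ U.card ≠ 0 := by simp
  refine mul_left_cancel₀ this ?_
  rw [h2, ← h3, ← h1]; ring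

end Sequential

/-! ### The law of the data as a product of conditional laws in temporal order. -/

section DataLaw

variable {S n A N T : ℕ}

/-- Factor of round `h` in the environment likelihood of an episode. -/
def BMDP.entry (Φ : BMDP S n A) (τ : Fin (N + 1) → Fin n × Fin A) (h : Fin (N + 1)) : ℝ :=
  Fin.cases (Φ.μ (τ 0).1)
    (fun k => Φ.ker (τ k.castSucc).1 (τ k.castSucc).2 (τ k.succ).1) h

theorem BMDP.episodeLik_eq_mul (Φ : BMDP S n A) (τ : Fin (N + 1) → Fin n × Fin A) :
    Φ.episodeLik τ = Φ.μ (τ 0).1 *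
      ∏ k : Fin N, Φ.ker (τ k.castSucc).1 (τ k.castSucc).2 (τ k.succ).1 := by
  unfold BMDP.episodeLik
  rw [Finset.prod_mul_distrib, Fin.prod_univ_succ, Fin.prod_univ_castSucc]
  simp
  left
  rfl

theorem BMDP.episodeLik_eq (Φ : BMDP S n A) (τ : Fin (N + 1) → Fin n × Fin A) :
    Φ.episodeLik τ = ∏ h, Φ.entry τ h := by
  rw [BMDP.episodeLik_eq_mul, Fin.prod_univ_succ]
  simp [BMDP.entry]

/-- Data indexed by the rounds of all episodes in their temporal order. -/
def dataEquiv (n A N T : ℕ) :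
    (Fin T ×ₗ Fin (N + 1) → Fin n × Fin A) ≃ Data n A (N + 1) T where
  toFun z := fun t h => z (toLex (t, h))
  invFun d := fun i => d (ofLex i).1 (ofLex i).2
  left_inv _ := rfl
  right_inv _ := rfl

@[simp]
theorem dataEquiv_apply (z : Fin T ×ₗ Fin (N + 1) → Fin n × Fin A) (t : Fin T)
    (h : Fin (N + 1)) : dataEquiv n A N T z t h = z (toLex (t, h)) := rfl

/-- Probability of the observation of round `i` given the past. -/
def Algorithm.stepProb (alg : Algorithm n A (N + 1) T) (Φ : BMDP S n A)
    (r : Reward n A (N + 1)) (i : Fin T ×ₗ Fin (N + 1))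
    (z : Fin T ×ₗ Fin (N + 1) → Fin n × Fin A) : ℝ :=
  Φ.entry (dataEquiv n A N T z (ofLex i).1) (ofLex i).2 *
    alg.explore r (ofLex i).1 (ofLex i).2 (dataEquiv n A N T z) (z i).2

theorem Algorithm.dataProb_eq_prod_stepProb (alg : Algorithm n A (N + 1) T) (Φ : BMDP S n A)
    (r : Reward n A (N + 1)) (z : Fin T ×ₗ Fin (N + 1) → Fin n × Fin A) :
    alg.dataProb Φ r (dataEquiv n A N T z) = ∏ i, alg.stepProb Φ r i z := by
  rw [← Equiv.prod_comp (toLex (α := Fin T × Fin (N + 1))), Fintype.prod_prod_type]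
  unfold Algorithm.dataProb
  refine Finset.prod_congr rfl fun t _ => ?_
  rw [BMDP.episodeLik_eq, ← Finset.prod_mul_distrib]
  rfl

/-- The environment looks back one round within the episode, and exploration uses only the past and
the current context. -/
theorem Algorithm.stepProb_congr (alg : Algorithm n A (N + 1) T) (Φ : BMDP S n A)
    (r : Reward n A (N + 1)) (i : Fin T ×ₗ Fin (N + 1))
    (d d' : Fin T ×ₗ Fin (N + 1) → Fin n × Fin A) (h : ∀ j ≤ i, d j = d' j) :
    alg.stepProb Φ r i d = alg.stepProb Φ r i d' := by
  obtain ⟨⟨t, k⟩, rfl⟩ := toLex.surjective i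
  have hh : ∀ t' k', (t' < t ∨ (t' = t ∧ k' ≤ k)) →
      d (toLex (t', k')) = d' (toLex (t', k')) := fun t' k' hk =>
    h _ (by rw [Prod.Lex.toLex_le_toLex]; exact hk)
  have e1 : alg.explore r t k (dataEquiv n A N T d) = alg.explore r t k (dataEquiv n A N T d') := by
    refine alg.explore_adapted r t k _ _ (fun t' k' hk => hh t' k' ?_) ?_
    · rcases hk with hk | hk
      · exact Or.inl hk
      · exact Or.inr ⟨hk.1, hk.2.le⟩
    · exact congrArg Prod.fst (hh t k (Or.inr ⟨rfl, le_rfl⟩))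
  have e2 : Φ.entry (dataEquiv n A N T d t) k = Φ.entry (dataEquiv n A N T d' t) k := by
    induction k using Fin.cases with
    | zero => simp only [BMDP.entry, Fin.cases_zero, dataEquiv_apply]
              rw [hh t 0 (Or.inr ⟨rfl, le_rfl⟩)]
    | succ k => simp only [BMDP.entry, Fin.cases_succ, dataEquiv_apply]
                rw [hh t k.succ (Or.inr ⟨rfl, le_rfl⟩),
                  hh t k.castSucc (Or.inr ⟨rfl, (Fin.castSucc_lt_succ (i := k)).le⟩)]
  change _ * alg.explore r t k _ _ = _ * alg.explore r t k _ _
  rw [e1, hh t k (Or.inr ⟨rfl, le_rfl⟩)]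
  congr 1

/-- Law of the context of round `h`, given the preceding rounds of the episode. -/
def BMDP.entryLaw (Φ : BMDP S n A) (τ : Fin (N + 1) → Fin n × Fin A) (h : Fin (N + 1))
    (y : Fin n) : ℝ :=
  Fin.cases (Φ.μ y) (fun k => Φ.ker (τ k.castSucc).1 (τ k.castSucc).2 y) h

/-- The environment factor of a round ignores the action of that round, so the exploration weights
can be summed out whatever the algorithm is. -/
theorem Algorithm.sum_stepProb_update (alg : Algorithm n A (N + 1) T) (Φ : BMDP S n A)
    (r : Reward n A (N + 1)) (t : Fin T) (k : Fin (N + 1))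
    (d : Fin T ×ₗ Fin (N + 1) → Fin n × Fin A) (φ : Fin n → ℝ) :
    ∑ ω, alg.stepProb Φ r (toLex (t, k)) (Function.update d (toLex (t, k)) ω) * φ ω.1
      = ∑ y, Φ.entryLaw (dataEquiv n A N T d t) k y * φ y := by
  rw [Fintype.sum_prod_type]
  refine Finset.sum_congr rfl fun y _ => ?_
  have hent : ∀ a, Φ.entry (dataEquiv n A N T (Function.update d (toLex (t, k)) (y, a)) t) k
      = Φ.entryLaw (dataEquiv n A N T d t) k y := by
    intro a
    induction k using Fin.cases with
    | zero => simp [BMDP.entry, BMDP.entryLaw]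
    | succ k =>
      have hne : (toLex (t, k.castSucc) : Fin T ×ₗ Fin (N + 1)) ≠ toLex (t, k.succ) := by
        intro h
        exact (Fin.castSucc_lt_succ (i := k)).ne (Prod.ext_iff.mp (toLex.injective h)).2
      simp [BMDP.entry, BMDP.entryLaw, Function.update_of_ne hne]
  have hexp : ∀ a a', alg.explore r t k
      (dataEquiv n A N T (Function.update d (toLex (t, k)) (y, a)))
      = alg.explore r t k (dataEquiv n A N T (Function.update d (toLex (t, k)) (y, a'))) := by
    intro a a'
    refine alg.explore_adapted r t k _ _ ?_ (by simp)
    intro t' k' hk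
    have hne : (toLex (t', k') : Fin T ×ₗ Fin (N + 1)) ≠ toLex (t, k) := by
      intro h
      obtain ⟨h1, h2⟩ := Prod.ext_iff.mp (toLex.injective h)
      rcases hk with hk | hk
      · exact hk.ne h1
      · exact hk.2.ne h2
    rw [dataEquiv_apply, dataEquiv_apply, Function.update_of_ne hne, Function.update_of_ne hne]
  have hs : ∑ a, alg.explore r t k
      (dataEquiv n A N T (Function.update d (toLex (t, k)) (y, a))) a = 1 := by
    -- Without actions an exploration vector could not sum to one. With an action `a₀`, adaptedness
    -- freezes the data at `a₀`, so that a single probability vector is summed.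
    rcases isEmpty_or_nonempty (Fin A) with hA | ⟨⟨a₀⟩⟩
    · have := (alg.explore_mem r t k (dataEquiv n A N T d)).2
      simp at this
    · rw [← (alg.explore_mem r t k
        (dataEquiv n A N T (Function.update d (toLex (t, k)) (y, a₀)))).2]
      exact Finset.sum_congr rfl fun a _ => by rw [hexp a a₀]
  calc _ = ∑ a, Φ.entryLaw (dataEquiv n A N T d t) k y * φ y *
        alg.explore r t k
          (dataEquiv n A N T (Function.update d (toLex (t, k)) (y, a))) a := by
        refine Finset.sum_congr rfl fun a _ => ?_
        rw [← hent a]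
        simp only [Algorithm.stepProb, ofLex_toLex, Function.update_self]
        ring
    _ = _ := by rw [← Finset.mul_sum, hs, mul_one]

/-- The laws of the context process: probability vectors. -/
structure BMDP.Stochastic (Φ : BMDP S n A) : Prop where
  sum_μ : ∑ x, Φ.μ x = 1
  sum_ker : ∀ x a, ∑ y, Φ.ker x a y = 1

theorem BMDP.Stochastic.sum_entryLaw {Φ : BMDP S n A} (hΦ : Φ.Stochastic)
    (τ : Fin (N + 1) → Fin n × Fin A) (h : Fin (N + 1)) : ∑ y, Φ.entryLaw τ h y = 1 := by
  induction h using Fin.cases with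
  | zero => simpa [BMDP.entryLaw] using hΦ.sum_μ
  | succ k => simpa [BMDP.entryLaw] using hΦ.sum_ker _ _

variable (alg : Algorithm n A (N + 1) T) {Φ : BMDP S n A} (r : Reward n A (N + 1))

theorem Algorithm.sum_stepProb (hΦ : Φ.Stochastic)
    (i : Fin T ×ₗ Fin (N + 1)) (d : Fin T ×ₗ Fin (N + 1) → Fin n × Fin A) :
    ∑ ω, alg.stepProb Φ r i (Function.update d i ω) = 1 := by
  obtain ⟨⟨t, k⟩, rfl⟩ := toLex.surjective i
  have := alg.sum_stepProb_update Φ r t k d (fun _ => 1)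
  simpa [hΦ.sum_entryLaw] using this

theorem Algorithm.sum_dataProb [Nonempty (Fin n × Fin A)] (hΦ : Φ.Stochastic) :
    ∑ d, alg.dataProb Φ r d = 1 := by
  rw [← Equiv.sum_comp (dataEquiv n A N T)]
  simp_rw [alg.dataProb_eq_prod_stepProb]
  exact sum_prod_eq_one (alg.stepProb_congr Φ r) (alg.sum_stepProb r hΦ)

/-- Conditioning on everything before round `k` of episode `t`. It yields both the Markov property
and the bound on visits to a context. -/
theorem Algorithm.sum_dataProb_mul_round [Nonempty (Fin n × Fin A)] (hΦ : Φ.Stochastic)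
    (t : Fin T) (k : Fin (N + 1))
    (φ : (Fin (N + 1) → Fin n × Fin A) → Fin n → ℝ)
    (hφ : ∀ τ τ', (∀ j < k, τ j = τ' j) → φ τ = φ τ') :
    ∑ d, alg.dataProb Φ r d * φ (d t) (d t k).1
      = ∑ d, alg.dataProb Φ r d * ∑ y, Φ.entryLaw (d t) k y * φ (d t) y := by
  rw [← Equiv.sum_comp (dataEquiv n A N T), ← Equiv.sum_comp (dataEquiv n A N T)]
  simp_rw [alg.dataProb_eq_prod_stepProb]
  have hag : ∀ d d' : Fin T ×ₗ Fin (N + 1) → Fin n × Fin A,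
      (∀ j < (toLex (t, k) : Fin T ×ₗ Fin (N + 1)), d j = d' j) →
      φ (dataEquiv n A N T d t) = φ (dataEquiv n A N T d' t) := fun d d' h =>
    hφ _ _ fun j hj => h _ (by rw [Prod.Lex.toLex_lt_toLex]; exact Or.inr ⟨rfl, hj⟩)
  rw [sum_prod_mul_eq_step (alg.stepProb_congr Φ r) (alg.sum_stepProb r hΦ) (toLex (t, k))]
  · refine Finset.sum_congr rfl fun d _ => ?_
    congr 1
    rw [← alg.sum_stepProb_update Φ r t k d]
    refine Finset.sum_congr rfl fun ω _ => ?_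
    rw [hag (Function.update d (toLex (t, k)) ω) d
      fun j hj => Function.update_of_ne hj.ne _ _]
    simp
  · intro d d' h
    have h1 := h _ le_rfl
    rw [hag d d' fun j hj => h j hj.le]
    simp only [dataEquiv_apply, h1]

/-- Markov property of the context process. -/
theorem Algorithm.sum_dataProb_mul_transition [Nonempty (Fin n × Fin A)] (hΦ : Φ.Stochastic)
    (t : Fin T) (k : Fin N) (φ : Fin n × Fin A → Fin n → ℝ) :
    ∑ d, alg.dataProb Φ r d * φ (d t k.castSucc) (d t k.succ).1
      = ∑ d, alg.dataProb Φ r d *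
          ∑ y, Φ.ker (d t k.castSucc).1 (d t k.castSucc).2 y * φ (d t k.castSucc) y := by
  have := alg.sum_dataProb_mul_round r hΦ t k.succ (fun τ y => φ (τ k.castSucc) y)
    (fun τ τ' h => by funext y; rw [h _ Fin.castSucc_lt_succ])
  simpa [BMDP.entryLaw] using this

end DataLaw

end BlockMDP

namespace BlockMDP

/-! ### Comparing two laws through their Kullback–Leibler divergence. -/

section ChangeOfMeasure

variable {Ω : Type*} [Fintype Ω] {E L₀ L₁ : Ω → ℝ}

/-- The Bhattacharyya bound: `exp (-KL) ≤ (∑ min) (∑ max)` for two mutually absolutely continuous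
probability vectors `L₀ E` and `L₁ E`. -/
theorem exp_neg_kl_le (hE : ∀ d, 0 ≤ E d) (h₀ : ∀ d, 0 < L₀ d) (h₁ : ∀ d, 0 < L₁ d)
    (s₀ : ∑ d, L₀ d * E d = 1) :
    Real.exp (-∑ d, L₀ d * E d * Real.log (L₀ d / L₁ d))
      ≤ (∑ d, min (L₀ d) (L₁ d) * E d) * ∑ d, max (L₀ d) (L₁ d) * E d := by
  have hmin : ∀ d, 0 ≤ min (L₀ d) (L₁ d) * E d := fun d =>
    mul_nonneg (le_min (h₀ d).le (h₁ d).le) (hE d)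
  have hmax : ∀ d, 0 ≤ max (L₀ d) (L₁ d) * E d := fun d =>
    mul_nonneg ((h₀ d).le.trans (le_max_left _ _)) (hE d)
  -- Jensen applied to half the log-likelihood ratio bounds `exp (-KL/2)` by the Bhattacharyya
  -- coefficient. Its terms factor as `√min * √max`, and Cauchy–Schwarz followed by squaring gives
  -- the claim. The common factor `E` may vanish, so it stays outside the logarithm.
  have hj := convexOn_exp.map_sum_le (t := Finset.univ) (w := fun d => L₀ d * E d)
    (p := fun d => -(1 / 2) * Real.log (L₀ d / L₁ d))
    (fun d _ => mul_nonneg (h₀ d).le (hE d)) s₀ (fun _ _ => Set.mem_univ _)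
  simp only [smul_eq_mul] at hj
  have hterm : ∀ d, L₀ d * E d * Real.exp (-(1 / 2) * Real.log (L₀ d / L₁ d))
      = √(min (L₀ d) (L₁ d) * E d) * √(max (L₀ d) (L₁ d) * E d) := by
    intro d
    rw [← Real.sqrt_mul (hmin d)]
    symm
    have hx : Real.exp (-(1 / 2) * Real.log (L₀ d / L₁ d)) ^ 2 = L₁ d / L₀ d := by
      rw [← Real.exp_nat_mul, ← Real.exp_log (div_pos (h₁ d) (h₀ d)),
        Real.log_div (h₁ d).ne' (h₀ d).ne', Real.log_div (h₀ d).ne' (h₁ d).ne']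
      congr 1
      push_cast
      ring
    rw [Real.sqrt_eq_iff_mul_self_eq (mul_nonneg (hmin d) (hmax d))
      (mul_nonneg (mul_nonneg (h₀ d).le (hE d)) (Real.exp_pos _).le)]
    symm
    calc _ = (L₀ d * E d) ^ 2 * Real.exp (-(1 / 2) * Real.log (L₀ d / L₁ d)) ^ 2 := by ring
      _ = L₀ d * L₁ d * E d ^ 2 := by rw [hx]; have := (h₀ d).ne'; field_simp
      _ = min (L₀ d) (L₁ d) * max (L₀ d) (L₁ d) * E d ^ 2 := by rw [min_mul_max]
      _ = _ := by ring
  simp_rw [hterm] at hj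
  have hcs := Real.sum_sqrt_mul_sqrt_le Finset.univ hmin hmax
  have h := hj.trans hcs
  have h2 := pow_le_pow_left₀ (Real.exp_pos _).le h 2
  rw [mul_pow, Real.sq_sqrt (Finset.sum_nonneg fun d _ => hmin d),
    Real.sq_sqrt (Finset.sum_nonneg fun d _ => hmax d), ← Real.exp_nat_mul] at h2
  refine le_trans (le_of_eq ?_) h2
  congr 1
  rw [Finset.mul_sum, ← Finset.sum_neg_distrib]
  refine Finset.sum_congr rfl fun d _ => ?_
  push_cast
  ring

theorem sum_min_add_sum_max (s₀ : ∑ d, L₀ d * E d = 1) (s₁ : ∑ d, L₁ d * E d = 1) :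
    ∑ d, min (L₀ d) (L₁ d) * E d + ∑ d, max (L₀ d) (L₁ d) * E d = 2 := by
  rw [← Finset.sum_add_distrib]
  calc _ = ∑ d, (L₀ d * E d + L₁ d * E d) :=
        Finset.sum_congr rfl fun d _ => by rw [← add_mul, min_add_max, add_mul]
    _ = 2 := by rw [Finset.sum_add_distrib, s₀, s₁]; norm_num

/-- The Bretagnolle–Huber inequality. -/
theorem bretagnolle_huber (hE : ∀ d, 0 ≤ E d) (h₀ : ∀ d, 0 < L₀ d) (h₁ : ∀ d, 0 < L₁ d)
    (s₀ : ∑ d, L₀ d * E d = 1) (s₁ : ∑ d, L₁ d * E d = 1) {g₀ g₁ : Ω → ℝ}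
    (hg₀ : ∀ d, 0 ≤ g₀ d) (hg₁ : ∀ d, 0 ≤ g₁ d) (hg : ∀ d, 1 ≤ g₀ d + g₁ d) :
    Real.exp (-∑ d, L₀ d * E d * Real.log (L₀ d / L₁ d)) / 2
      ≤ ∑ d, L₀ d * E d * g₀ d + ∑ d, L₁ d * E d * g₁ d := by
  have hb := exp_neg_kl_le hE h₀ h₁ s₀
  have hs := sum_min_add_sum_max s₀ s₁
  have hmin : 0 ≤ ∑ d, min (L₀ d) (L₁ d) * E d := Finset.sum_nonneg fun d _ =>
    mul_nonneg (le_min (h₀ d).le (h₁ d).le) (hE d)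
  have hle : ∑ d, min (L₀ d) (L₁ d) * E d
      ≤ ∑ d, L₀ d * E d * g₀ d + ∑ d, L₁ d * E d * g₁ d := by
    rw [← Finset.sum_add_distrib]
    refine Finset.sum_le_sum fun d _ => ?_
    have hm : 0 ≤ min (L₀ d) (L₁ d) * E d := mul_nonneg (le_min (h₀ d).le (h₁ d).le) (hE d)
    calc min (L₀ d) (L₁ d) * E d ≤ min (L₀ d) (L₁ d) * E d * (g₀ d + g₁ d) :=
          le_mul_of_one_le_right hm (hg d)
      _ = min (L₀ d) (L₁ d) * E d * g₀ d + min (L₀ d) (L₁ d) * E d * g₁ d := by ring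
      _ ≤ _ := add_le_add
          (mul_le_mul_of_nonneg_right (mul_le_mul_of_nonneg_right (min_le_left _ _) (hE d))
            (hg₀ d))
          (mul_le_mul_of_nonneg_right (mul_le_mul_of_nonneg_right (min_le_right _ _) (hE d))
            (hg₁ d))
  -- The sum of maxima is `2 - ∑ min ≤ 2`.
  nlinarith

/-- A linearized Pinsker inequality. -/
theorem sum_le_sum_add_kl (hE : ∀ d, 0 ≤ E d) (h₀ : ∀ d, 0 < L₀ d) (h₁ : ∀ d, 0 < L₁ d)
    (s₀ : ∑ d, L₀ d * E d = 1) (s₁ : ∑ d, L₁ d * E d = 1) {g : Ω → ℝ}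
    (hg₀ : ∀ d, 0 ≤ g d) (hg₁ : ∀ d, g d ≤ 1) :
    ∑ d, L₁ d * E d * g d
      ≤ ∑ d, L₀ d * E d * g d + 1 / 8 + 2 * ∑ d, L₀ d * E d * Real.log (L₀ d / L₁ d) := by
  have hb := exp_neg_kl_le hE h₀ h₁ s₀
  have hs := sum_min_add_sum_max s₀ s₁
  set K := ∑ d, L₀ d * E d * Real.log (L₀ d / L₁ d)
  set m := ∑ d, min (L₀ d) (L₁ d) * E d
  have hle : ∑ d, L₁ d * E d * g d - ∑ d, L₀ d * E d * g d ≤ 1 - m := by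
    rw [← s₁, ← Finset.sum_sub_distrib, ← Finset.sum_sub_distrib]
    refine Finset.sum_le_sum fun d _ => ?_
    have hm : 0 ≤ (L₁ d - min (L₀ d) (L₁ d)) * E d :=
      mul_nonneg (sub_nonneg.mpr (min_le_right _ _)) (hE d)
    have hm' : 0 ≤ (L₀ d - min (L₀ d) (L₁ d)) * E d :=
      mul_nonneg (sub_nonneg.mpr (min_le_left _ _)) (hE d)
    nlinarith [mul_nonneg hm (sub_nonneg.mpr (hg₁ d)), mul_nonneg hm' (hg₀ d)]
  -- `1 - K ≤ m (2 - m) = 1 - (1 - m)²` gives `(1 - m)² ≤ K`; then `t ≤ 1/8 + 2 t²` at `t = 1 - m`,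
  -- which is `(t - 1/4)² ≥ 0`.
  have hexp := Real.add_one_le_exp (-K)
  have hM : ∑ d, max (L₀ d) (L₁ d) * E d = 2 - m := by linarith
  rw [hM] at hb
  nlinarith [sq_nonneg (1 - m - 1 / 4)]

end ChangeOfMeasure

/-! ### Divergence between the data laws of two models. -/

section DataDivergence

variable {S n A N T : ℕ}

/-- The environment part of the likelihood of the data. -/
def BMDP.dataLik (Φ : BMDP S n A) (d : Data n A (N + 1) T) : ℝ := ∏ t, Φ.episodeLik (d t)

/-- The algorithm part of the likelihood of the data. -/
def Algorithm.exploreLik (alg : Algorithm n A (N + 1) T) (r : Reward n A (N + 1))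
    (d : Data n A (N + 1) T) : ℝ := ∏ t, ∏ h, alg.explore r t h d (d t h).2

variable (alg : Algorithm n A (N + 1) T) (r : Reward n A (N + 1))

theorem Algorithm.dataProb_eq (Φ : BMDP S n A) (d : Data n A (N + 1) T) :
    alg.dataProb Φ r d = Φ.dataLik d * alg.exploreLik r d :=
  Finset.prod_mul_distrib

theorem Algorithm.exploreLik_nonneg (d : Data n A (N + 1) T) : 0 ≤ alg.exploreLik r d :=
  Finset.prod_nonneg fun t _ => Finset.prod_nonneg fun h _ => (alg.explore_mem r t h d).1 _

/-- A context process with uniform start and positive transition probabilities. -/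
structure BMDP.Positive (Φ : BMDP S n A) : Prop extends Φ.Stochastic where
  uniform : Φ.UniformStart
  ker_pos : ∀ x a y, 0 < Φ.ker x a y

variable {Φ Φ₀ Φ₁ : BMDP S n A}

theorem BMDP.Positive.μ_pos (hΦ : Φ.Positive) (x : Fin n) : 0 < Φ.μ x := by
  rw [hΦ.uniform x]
  have : 0 < n := x.pos
  positivity

theorem BMDP.Positive.episodeLik_pos (hΦ : Φ.Positive) (τ : Fin (N + 1) → Fin n × Fin A) :
    0 < Φ.episodeLik τ := by
  rw [BMDP.episodeLik_eq_mul]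
  exact mul_pos (hΦ.μ_pos _) (Finset.prod_pos fun k _ => hΦ.ker_pos _ _ _)

theorem BMDP.Positive.dataLik_pos (hΦ : Φ.Positive) (d : Data n A (N + 1) T) :
    0 < Φ.dataLik d :=
  Finset.prod_pos fun _ _ => hΦ.episodeLik_pos _

theorem BMDP.Positive.dataProb_nonneg (hΦ : Φ.Positive) (d : Data n A (N + 1) T) :
    0 ≤ alg.dataProb Φ r d := by
  rw [alg.dataProb_eq]
  exact mul_nonneg (hΦ.dataLik_pos d).le (alg.exploreLik_nonneg r d)

/-- Both models start uniformly, so the initial laws cancel and only the `N` transitions of each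
episode carry information. -/
theorem BMDP.log_dataLik_div (h₀ : Φ₀.Positive) (h₁ : Φ₁.Positive) (d : Data n A (N + 1) T) :
    Real.log (Φ₀.dataLik d / Φ₁.dataLik d)
      = ∑ t, ∑ k : Fin N, Real.log
          (Φ₀.ker (d t k.castSucc).1 (d t k.castSucc).2 (d t k.succ).1 /
            Φ₁.ker (d t k.castSucc).1 (d t k.castSucc).2 (d t k.succ).1) := by
  unfold BMDP.dataLik
  rw [← Finset.prod_div_distrib, Real.log_prod
    (fun t _ => (div_pos (h₀.episodeLik_pos _) (h₁.episodeLik_pos _)).ne')]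
  refine Finset.sum_congr rfl fun t _ => ?_
  rw [BMDP.episodeLik_eq_mul, BMDP.episodeLik_eq_mul, h₀.uniform, h₁.uniform,
    mul_div_mul_left _ _ (by rw [← h₀.uniform (d t 0).1]; exact (h₀.μ_pos _).ne'),
    ← Finset.prod_div_distrib, Real.log_prod
      (fun k _ => (div_pos (h₀.ker_pos _ _ _) (h₁.ker_pos _ _ _)).ne')]

/-- The chain rule for the divergence between the laws of the data, with each conditional
divergence bounded by the chi-square divergence. -/
theorem Algorithm.kl_le [Nonempty (Fin n × Fin A)] (h₀ : Φ₀.Positive) (h₁ : Φ₁.Positive)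
    {D : Fin n × Fin A → ℝ}
    (hD : ∀ z, ∑ y, (Φ₀.ker z.1 z.2 y - Φ₁.ker z.1 z.2 y) ^ 2 / Φ₁.ker z.1 z.2 y ≤ D z) :
    ∑ d : Data n A (N + 1) T, Φ₀.dataLik d * alg.exploreLik r d
        * Real.log (Φ₀.dataLik d / Φ₁.dataLik d)
      ≤ ∑ t, ∑ k : Fin N, ∑ d, alg.dataProb Φ₀ r d * D (d t k.castSucc) := by
  have hkl : ∀ z : Fin n × Fin A, ∑ y, Φ₀.ker z.1 z.2 y *
      Real.log (Φ₀.ker z.1 z.2 y / Φ₁.ker z.1 z.2 y) ≤ D z := by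
    intro z
    refine le_trans ?_ (hD z)
    -- Adding this zero turns the chi-square terms into `P₀ (P₀/P₁ - 1)`, which `log t ≤ t - 1`
    -- compares with the divergence term by term.
    have hsum : ∑ y, (Φ₀.ker z.1 z.2 y - Φ₁.ker z.1 z.2 y) = 0 := by
      rw [Finset.sum_sub_distrib, h₀.sum_ker, h₁.sum_ker, sub_self]
    rw [← add_zero (∑ y, (Φ₀.ker z.1 z.2 y - Φ₁.ker z.1 z.2 y) ^ 2 / Φ₁.ker z.1 z.2 y),
      ← hsum, ← Finset.sum_add_distrib]
    refine Finset.sum_le_sum fun y _ => ?_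
    have p₀ := h₀.ker_pos z.1 z.2 y
    have p₁ := h₁.ker_pos z.1 z.2 y
    calc _ ≤ Φ₀.ker z.1 z.2 y * (Φ₀.ker z.1 z.2 y / Φ₁.ker z.1 z.2 y - 1) :=
          mul_le_mul_of_nonneg_left (Real.log_le_sub_one_of_pos (div_pos p₀ p₁)) p₀.le
      _ = _ := by field_simp; ring
  simp_rw [← alg.dataProb_eq, BMDP.log_dataLik_div h₀ h₁, Finset.mul_sum]
  rw [Finset.sum_comm]
  refine Finset.sum_le_sum fun t _ => ?_
  rw [Finset.sum_comm]
  refine Finset.sum_le_sum fun k _ => ?_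
  rw [alg.sum_dataProb_mul_transition r h₀.toStochastic t k
    (fun z y => Real.log (Φ₀.ker z.1 z.2 y / Φ₁.ker z.1 z.2 y))]
  exact Finset.sum_le_sum fun d _ =>
    mul_le_mul_of_nonneg_left (hkl _) (h₀.dataProb_nonneg alg r d)

/-- Every round visits a context with probability at most the largest transition probability
into it. -/
theorem Algorithm.sum_dataProb_mul_context_le [Nonempty (Fin n × Fin A)] (h₀ : Φ₀.Positive)
    {C : ℝ} (hC : 1 ≤ C) (hker : ∀ x a y, Φ₀.ker x a y ≤ C / n) (t : Fin T) (k : Fin (N + 1))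
    {g : Fin n → ℝ} (hg : ∀ x, 0 ≤ g x) :
    ∑ d, alg.dataProb Φ₀ r d * g (d t k).1 ≤ C / n * ∑ y, g y := by
  rw [Finset.mul_sum, alg.sum_dataProb_mul_round r h₀.toStochastic t k (fun _ => g) (by simp)]
  rw [← one_mul (∑ y, C / n * g y), ← alg.sum_dataProb r h₀.toStochastic, Finset.sum_mul]
  refine Finset.sum_le_sum fun d _ => mul_le_mul_of_nonneg_left ?_ (h₀.dataProb_nonneg alg r d)
  refine Finset.sum_le_sum fun y _ => mul_le_mul_of_nonneg_right ?_ (hg y)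
  induction k using Fin.cases with
  | zero =>
    simp only [BMDP.entryLaw, Fin.cases_zero]
    rw [h₀.uniform y]
    gcongr
  | succ k => exact hker _ _ _

end DataDivergence

end BlockMDP

/-! ### Positivity of the rate function. -/

namespace BlockMDP

/-- Apply `log t ≤ t - 1` to `t = √y / √x`. The linear part `x - y` is kept explicit because it
cancels between complementary outcomes. -/
theorem sub_add_sq_le_mul_log {x y : ℝ} (hx : 0 < x) (hy : 0 < y) :
    x - y + (√x - √y) ^ 2 ≤ x * Real.log (x / y) := by
  have sx := Real.sqrt_pos.mpr hx
  have sy := Real.sqrt_pos.mpr hy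
  have h := Real.log_le_sub_one_of_pos (div_pos sy sx)
  have hl : Real.log (x / y) = -2 * Real.log (√y / √x) := by
    rw [Real.log_div hx.ne' hy.ne', Real.log_div sy.ne' sx.ne', Real.log_sqrt hx.le,
      Real.log_sqrt hy.le]
    ring
  have hxy : x * (√y / √x) = √x * √y := by
    field_simp
    rw [Real.sq_sqrt hx.le]
  have := mul_le_mul_of_nonneg_left h hx.le
  rw [hl]
  nlinarith [Real.sq_sqrt hx.le, Real.sq_sqrt hy.le]

variable {S n A H : ℕ} {η : ℝ} {Φ : BMDP S n A}

theorem BMDP.WellDefined.q_pos (wd : Φ.WellDefined) (x : Fin n) : 0 < Φ.q (Φ.f x) x := by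
  refine lt_of_le_of_ne ((wd.q_mem _).1 _) (Ne.symm ?_)
  have : x ∈ Function.support (Φ.q (Φ.f x)) := by rw [wd.q_support]; simp
  exact this

theorem le_one_of_mem_stdSimplex {ι : Type*} [Fintype ι] {p : ι → ℝ} (hp : p ∈ stdSimplex ℝ ι)
    (i : ι) : p i ≤ 1 :=
  hp.2 ▸ Finset.single_le_sum (f := p) (fun j _ => hp.1 j) (Finset.mem_univ i)

theorem BMDP.WellDefined.ker_nonneg (wd : Φ.WellDefined) (x : Fin n) (a : Fin A) (y : Fin n) :
    0 ≤ Φ.ker x a y :=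
  mul_nonneg ((wd.q_mem _).1 _) ((wd.p_mem _ _).1 _)

theorem BMDP.WellDefined.ctxLaw_nonneg (wd : Φ.WellDefined) (π : Policy n A H) (k : ℕ)
    (x : Fin n) : 0 ≤ Φ.ctxLaw π k x := by
  induction k generalizing x with
  | zero => exact wd.μ_mem.1 x
  | succ k ih =>
    rw [BMDP.ctxLaw]
    split_ifs with hk
    · exact Finset.sum_nonneg fun z _ => Finset.sum_nonneg fun a _ =>
        mul_nonneg (mul_nonneg (ih z) ((π.2 _ _).1 a)) (wd.ker_nonneg z a x)
    · exact le_rfl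

theorem BMDP.WellDefined.occupation_nonneg (wd : Φ.WellDefined) (hH : 2 ≤ H) (π : Policy n A H)
    (s : Fin S) (a : Fin A) : 0 ≤ Φ.occupation π s a := by
  have hH' : (2 : ℝ) ≤ H := by exact_mod_cast hH
  refine mul_nonneg (by apply div_nonneg <;> linarith) (Finset.sum_nonneg fun h _ => ?_)
  split_ifs
  · refine Finset.sum_nonneg fun x _ => ?_
    split_ifs
    · exact mul_nonneg (wd.ctxLaw_nonneg π _ x) ((π.2 _ _).1 a)
    · exact le_rfl
  · exact le_rfl

theorem BMDP.WellDefined.le_occupation (wd : Φ.WellDefined) (hH : 2 ≤ H) (π : Policy n A H)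
    (x : Fin n) (a : Fin A) :
    1 / ((H : ℝ) - 1) * (Φ.μ x * π.1 ⟨0, by omega⟩ x a) ≤ Φ.occupation π (Φ.f x) a := by
  have hH' : (2 : ℝ) ≤ H := by exact_mod_cast hH
  refine mul_le_mul_of_nonneg_left ?_ (by apply div_nonneg <;> linarith)
  have hin : ∀ h : Fin H, ∀ y, 0 ≤ (if Φ.f y = Φ.f x then Φ.ctxLaw π h y * π.1 h y a else 0) := by
    intro h y
    split_ifs
    · exact mul_nonneg (wd.ctxLaw_nonneg π _ y) ((π.2 _ _).1 a)
    · exact le_rfl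
  have hout : ∀ h : Fin H, 0 ≤ (if (h : ℕ) + 1 < H then
      ∑ y, (if Φ.f y = Φ.f x then Φ.ctxLaw π h y * π.1 h y a else 0) else 0) := by
    intro h
    split_ifs
    · exact Finset.sum_nonneg fun y _ => hin h y
    · exact le_rfl
  refine le_trans ?_ (Finset.single_le_sum (fun h _ => hout h)
    (Finset.mem_univ (⟨0, by omega⟩ : Fin H)))
  rw [if_pos (show 0 + 1 < H by omega)]
  refine le_trans ?_ (Finset.single_le_sum (fun y _ => hin _ y) (Finset.mem_univ x))
  simp [BMDP.ctxLaw]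

/-- By the ratio bound one vanishing entry would make the whole row vanish. -/
theorem BMDP.Regular.p_pos (reg : Φ.Regular η) (wd : Φ.WellDefined) (hη : 0 < η)
    (s : Fin S) (a : Fin A) (s' : Fin S) : 0 < Φ.p s a s' := by
  by_contra h
  have h0 : ∀ t, Φ.p s a t = 0 := fun t => le_antisymm
    ((reg.p_out_le a s t s').trans (mul_nonpos_of_nonneg_of_nonpos hη.le (not_lt.mp h)))
    ((wd.p_mem s a).1 t)
  have := (wd.p_mem s a).2
  simp [h0] at this

theorem Policy.Regular.pos {π : Policy n A H} (hπ : π.Regular η) (hη : 0 < η) (h : Fin H)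
    (x : Fin n) (a : Fin A) : 0 < π.1 h x a := by
  by_contra h0
  have h1 : ∀ b, π.1 h x b = 0 := fun b => le_antisymm
    ((hπ h x x b a).trans (mul_nonpos_of_nonneg_of_nonpos hη.le (not_lt.mp h0)))
    ((π.2 h x).1 b)
  have := (π.2 h x).2
  simp [h1] at this

/-- If `q(x | i) = 1`, moving `x` leaves an emission vector of `i` that is identically zero. If `c
q(x | i) ≥ 1`, the contexts already in the nonempty cluster `j` lose their positive emission
probability. -/
theorem BMDP.confusing_lt_one (wd : Φ.WellDefined) (hpos : ∀ s, 0 < Φ.alpha s)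
    {x : Fin n} {j : Fin S} (hj : j ≠ Φ.f x) {c : ℝ}
    (hΨ : (Φ.confusing x j c).WellDefined) :
    Φ.q (Φ.f x) x < 1 ∧ c * Φ.q (Φ.f x) x < 1 := by
  constructor
  · refine lt_of_le_of_ne (le_one_of_mem_stdSimplex (wd.q_mem _) x) fun h => ?_
    have := (hΨ.q_mem (Φ.f x)).2
    simp [BMDP.confusing, h] at this
  · obtain ⟨y, hy⟩ : ∃ y, Φ.f y = j := by
      by_contra! hne
      have := hpos j
      rw [BMDP.alpha, Finset.filter_false_of_mem (fun y _ => hne y)] at this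
      simp at this
    have hyx : y ≠ x := by rintro rfl; exact hj hy.symm
    have h0 : 0 < (Φ.confusing x j c).q j y := by
      have := hΨ.q_pos y
      simpa [BMDP.confusing, Function.update_of_ne hyx, hy] using this
    simp only [BMDP.confusing, if_neg hj, if_pos, if_neg hyx] at h0
    have := pos_of_mul_pos_left h0 ((wd.q_mem j).1 y)
    linarith

/-- The divergence rate dominates squared Hellinger distances between the incoming and outgoing
transition probabilities. -/
theorem le_rate_summand {u v c m' : ℝ} {P P' : Fin S → ℝ} {M Pj Pi : Fin S → ℝ}
    (hm : ∀ s, 0 ≤ M s) (hm' : 0 ≤ m') (hu : 0 < u) (hu1 : u < 1) (hv : 0 < v) (hv1 : v < 1)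
    (huc : u = c * v) (hP : ∀ s, 0 < P s) (hP' : ∀ s, 0 < P' s) (sP : ∑ s, P s = 1)
    (sP' : ∑ s, P' s = 1) (hPj : ∀ s, 0 < Pj s) (hPi : ∀ s, 0 < Pi s) (hPj1 : ∀ s, Pj s ≤ 1)
    (hPi1 : ∀ s, Pi s ≤ 1) :
    ∑ s, M s * (√(u * Pj s) - √(v * Pi s)) ^ 2 + u * m' * ∑ s, (√(P s) - √(P' s)) ^ 2
      ≤ ∑ s, (u * Pj s * M s * Real.log (c * Pj s / Pi s)
        + u * m' * P s * Real.log (P s / P' s)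
        + (1 - u * Pj s) * M s * Real.log ((1 - u * Pj s) / (1 - v * Pi s))) := by
  have h2 : ∑ s, (√(P s) - √(P' s)) ^ 2 ≤ ∑ s, P s * Real.log (P s / P' s) := by
    calc _ = ∑ s, (P s - P' s + (√(P s) - √(P' s)) ^ 2) := by
          rw [Finset.sum_add_distrib, Finset.sum_sub_distrib, sP, sP']; ring
      _ ≤ _ := Finset.sum_le_sum fun s _ => sub_add_sq_le_mul_log (hP s) (hP' s)
  have h2' := mul_le_mul_of_nonneg_left h2 (mul_nonneg hu.le hm')
  refine (add_le_add_right h2' _).trans ?_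
  rw [Finset.mul_sum, ← Finset.sum_add_distrib]
  refine Finset.sum_le_sum fun s _ => ?_
  have e1 : c * Pj s / Pi s = (u * Pj s) / (v * Pi s) := by
    rw [huc]; have := (hPi s).ne'; field_simp
  have b1 := sub_add_sq_le_mul_log (mul_pos hu (hPj s)) (mul_pos hv (hPi s))
  have p1 : 0 < 1 - u * Pj s := by nlinarith [hPj1 s, hPj s]
  have p2 : 0 < 1 - v * Pi s := by nlinarith [hPi1 s, hPi s]
  -- The linear parts of `b1` and `b2` cancel; the squared difference in `b2` is nonnegative and is
  -- dropped.
  have b2 := sub_add_sq_le_mul_log p1 p2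
  rw [e1]
  nlinarith [mul_le_mul_of_nonneg_left (add_le_add b1 b2) (hm s),
    mul_nonneg (hm s) (sq_nonneg (√(1 - u * Pj s) - √(1 - v * Pi s)))]

/-- A regular block MDP whose latent states have pairwise different transition probabilities is
separable. -/
theorem BMDP.separable_of_rows_ne (hH : 2 ≤ H) (hη : 0 < η) (wd : Φ.WellDefined)
    (reg : Φ.Regular η) (unif : Φ.UniformStart)
    (rows : ∀ i j, i ≠ j → ∃ a s, Φ.p j a s ≠ Φ.p i a s) : Φ.Separable H η := by
  intro π hπ x
  have hn : (0 : ℝ) < n := by exact_mod_cast x.pos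
  have hH' : (2 : ℝ) ≤ H := by exact_mod_cast hH
  have : Nonempty (Fin S) := ⟨Φ.f x⟩
  -- The minimum over the finitely many `j` is attained, so one `j` is enough; at `j = f x` the
  -- inner infimum is `⊤`. The infimum over `c` need not be attained and requires a bound uniform in
  -- `c`.
  obtain ⟨j, hjeq⟩ := exists_eq_ciInf_of_finite
    (f := fun j : Fin S => ⨅ (_ : j ≠ Φ.f x) (c : ℝ) (_ : 0 < c), Φ.rateAt π x j c)
  unfold BMDP.rate
  rw [← hjeq]
  by_cases hj : j ≠ Φ.f x
  swap
  · simp [hj]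
  obtain ⟨a₀, s₀, hs₀⟩ := rows _ _ hj.symm
  have hp := reg.p_pos wd hη
  have hp1 : ∀ s a s', Φ.p s a s' ≤ 1 := fun s a => le_one_of_mem_stdSimplex (wd.p_mem s a)
  set v := Φ.q (Φ.f x) x with hv
  have hvpos : 0 < v := wd.q_pos x
  set m₀ := 1 / ((H : ℝ) - 1) * (Φ.μ x * π.1 ⟨0, by omega⟩ x a₀) with hm₀
  have hm₀pos : 0 < m₀ := by
    rw [hm₀, unif]
    have := hπ.pos hη ⟨0, by omega⟩ x a₀
    have : 0 < (H : ℝ) - 1 := by linarith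
    positivity
  set b := v * Φ.p j a₀ (Φ.f x) with hb
  have hbpos : 0 < b := mul_pos hvpos (hp _ _ _)
  set B₁ := (√b - √(b / 2)) ^ 2 with hB₁
  set B₂ := 1 / (2 * η) * v * (√(Φ.p j a₀ s₀) - √(Φ.p (Φ.f x) a₀ s₀)) ^ 2 with hB₂
  have hsq : √(b / 2) < √b := Real.sqrt_lt_sqrt (by positivity) (by linarith)
  have hB₁pos : 0 < B₁ := pow_pos (sub_pos.mpr hsq) 2
  have hB₂pos : 0 < B₂ := by
    have : √(Φ.p j a₀ s₀) - √(Φ.p (Φ.f x) a₀ s₀) ≠ 0 := by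
      rw [sub_ne_zero]
      intro h
      exact hs₀ ((Real.sqrt_inj (hp _ _ _).le (hp _ _ _).le).mp h)
    have := sq_pos_of_ne_zero this
    positivity
  refine lt_of_lt_of_le (b := (((n : ℝ) * (m₀ * min B₁ B₂) : ℝ) : EReal)) ?_ ?_
  · exact_mod_cast mul_pos hn (mul_pos hm₀pos (lt_min hB₁pos hB₂pos))
  refine le_iInf fun _ => le_iInf fun c => le_iInf fun hc => ?_
  unfold BMDP.rateAt
  split_ifs with hΨ
  swap
  · exact le_top
  rw [EReal.coe_le_coe_iff]
  refine mul_le_mul_of_nonneg_left ?_ hn.le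
  obtain ⟨hv1, hu1⟩ := BMDP.confusing_lt_one wd reg.alpha_pos hj hΨ
  have hu : 0 < c * v := mul_pos hc hvpos
  have hocc := fun s a => hΨ.occupation_nonneg hH π s a
  -- In the modified model `x` itself belongs to cluster `j`, so its uniform initial mass bounds the
  -- occupation of `j` independently of `c`.
  have hocc₀ : m₀ ≤ (Φ.confusing x j c).occupation π j a₀ := by
    have := hΨ.le_occupation hH π x a₀
    rwa [show (Φ.confusing x j c).f x = j from Function.update_self ..] at this
  have hsum := fun a => le_rate_summand (c := c)
    (fun s => hocc s a) (hocc j a) hu hu1 hvpos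
    hv1 rfl (fun s => hp j a s) (fun s => hp (Φ.f x) a s) (wd.p_mem j a).2 (wd.p_mem _ a).2
    (fun s => hp s a j) (fun s => hp s a (Φ.f x)) (fun s => hp1 s a j)
    (fun s => hp1 s a (Φ.f x))
  have hnn : ∀ a, 0 ≤ ∑ s, (Φ.confusing x j c).occupation π s a *
      (√(c * v * Φ.p s a j) - √(v * Φ.p s a (Φ.f x))) ^ 2
      + c * v * (Φ.confusing x j c).occupation π j a *
        ∑ s, (√(Φ.p j a s) - √(Φ.p (Φ.f x) a s)) ^ 2 := fun a =>
    add_nonneg (Finset.sum_nonneg fun s _ => mul_nonneg (hocc s a) (sq_nonneg _))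
      (mul_nonneg (mul_nonneg hu.le (hocc j a)) (Finset.sum_nonneg fun s _ => sq_nonneg _))
  refine le_trans ?_ (Finset.single_le_sum (fun a _ => (hnn a).trans (hsum a))
    (Finset.mem_univ a₀))
  refine le_trans ?_ (hsum a₀)
  -- For small `c` the transition `j → j` into the cluster differs from `j → i`: by regularity `c v
  -- p(j | j, a₀) ≤ b / 2`. For larger `c` the factor `u = c v` is bounded below and the difference
  -- of the rows at `s₀` counts.
  by_cases hcη : c ≤ 1 / (2 * η)
  · refine le_add_of_le_of_nonneg (le_trans ?_ (Finset.single_le_sum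
      (fun s _ => mul_nonneg (hocc s a₀) (sq_nonneg _)) (Finset.mem_univ j)))
      (mul_nonneg (mul_nonneg hu.le (hocc j a₀)) (Finset.sum_nonneg fun s _ => sq_nonneg _))
    refine mul_le_mul hocc₀ ((min_le_left _ _).trans ?_) (lt_min hB₁pos hB₂pos).le (hocc _ _)
    have hle : c * v * Φ.p j a₀ j ≤ b / 2 := by
      have h1 := reg.p_out_le a₀ j j (Φ.f x)
      have h2 : c * (2 * η) ≤ 1 := by rwa [le_div_iff₀ (by positivity)] at hcη
      have h3 : c * Φ.p j a₀ j ≤ Φ.p j a₀ (Φ.f x) / 2 := by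
        nlinarith [mul_le_mul_of_nonneg_left h1 hc.le, hp j a₀ (Φ.f x)]
      rw [hb]
      nlinarith [mul_le_mul_of_nonneg_left h3 hvpos.le]
    have hs := Real.sqrt_le_sqrt hle
    rw [hB₁, ← neg_sq (√(c * v * Φ.p j a₀ j) - _), neg_sub]
    refine pow_le_pow_left₀ (by linarith) (by linarith) 2
  · push Not at hcη
    refine le_add_of_nonneg_of_le (Finset.sum_nonneg fun s _ =>
      mul_nonneg (hocc s a₀) (sq_nonneg _)) ?_
    have hS : (√(Φ.p j a₀ s₀) - √(Φ.p (Φ.f x) a₀ s₀)) ^ 2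
        ≤ ∑ s, (√(Φ.p j a₀ s) - √(Φ.p (Φ.f x) a₀ s)) ^ 2 :=
      Finset.single_le_sum (f := fun s => (√(Φ.p j a₀ s) - √(Φ.p (Φ.f x) a₀ s)) ^ 2)
        (fun s _ => sq_nonneg _) (Finset.mem_univ s₀)
    calc m₀ * min B₁ B₂ ≤ (Φ.confusing x j c).occupation π j a₀ * B₂ :=
          mul_le_mul hocc₀ (min_le_right _ _) (lt_min hB₁pos hB₂pos).le (hocc _ _)
      _ ≤ (Φ.confusing x j c).occupation π j a₀ *
          (c * v * (√(Φ.p j a₀ s₀) - √(Φ.p (Φ.f x) a₀ s₀)) ^ 2) :=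
          mul_le_mul_of_nonneg_left (by rw [hB₂]; gcongr) (hocc _ _)
      _ ≤ (Φ.confusing x j c).occupation π j a₀ *
          (c * v * ∑ s, (√(Φ.p j a₀ s) - √(Φ.p (Φ.f x) a₀ s)) ^ 2) := by
          gcongr
          exact hocc _ _
      _ = _ := by ring

end BlockMDP

/-! ### Tilted models and their membership in the class. -/

noncomputable section

namespace BlockMDP

variable {S n A N T : ℕ}

/-- The mean of `b` over the contexts. -/
def meanLabel (f : Fin n → Fin S) (b : Fin S → ℝ) : ℝ := 1 / (n : ℝ) * ∑ x, b (f x)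

/-- Size of a cluster. -/
def clusterSize (f : Fin n → Fin S) (s : Fin S) : ℝ :=
  ((Finset.univ.filter fun x => f x = s).card : ℝ)

/-- The block MDP in which action `a` in latent state `s` tilts the uniform law of the next
context by `δ s a` in the direction of the centred label `b`. -/
def tiltedModel (f : Fin n → Fin S) (b : Fin S → ℝ) (δ : Fin S → Fin A → ℝ) : BMDP S n A where
  μ _ := 1 / (n : ℝ)
  p s a s' := clusterSize f s' / n * (1 + δ s a * (b s' - meanLabel f b))
  q s x := if f x = s then 1 / clusterSize f s else 0
  f := f

/-- Standing assumptions on the parameters of a tilted model. -/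
structure TiltBounds (f : Fin n → Fin S) (b : Fin S → ℝ) (δ : Fin S → Fin A → ℝ) (Δ : ℝ) :
    Prop where
  n_pos : 0 < n
  b_mem : ∀ s, b s ∈ Set.Icc (0 : ℝ) 1
  abs_tilt_le : ∀ s a, |δ s a| ≤ Δ
  bound_le : Δ ≤ 1 / 2
  size_pos : ∀ s, 0 < clusterSize f s

theorem sum_clusterSize_mul (f : Fin n → Fin S) (g : Fin S → ℝ) :
    ∑ s, clusterSize f s * g s = ∑ x, g (f x) := by
  rw [← Finset.sum_fiberwise Finset.univ f]
  refine Finset.sum_congr rfl fun s _ => ?_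
  rw [Finset.sum_congr rfl (g := fun _ => g s)
    (fun x hx => by rw [(Finset.mem_filter.mp hx).2])]
  simp [clusterSize]

/-- The centred label sums to zero, so no tilt affects the normalization. -/
theorem sum_centred (hn : 0 < n) (f : Fin n → Fin S) (b : Fin S → ℝ) (D : ℝ) :
    ∑ y, 1 / (n : ℝ) * (1 + D * (b (f y) - meanLabel f b)) = 1 := by
  have : (n : ℝ) ≠ 0 := by positivity
  rw [← Finset.mul_sum, Finset.sum_add_distrib, ← Finset.mul_sum, Finset.sum_sub_distrib]
  simp only [meanLabel, Finset.sum_const, Finset.card_univ, Fintype.card_fin, nsmul_eq_mul]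
  field_simp
  ring

namespace TiltBounds

variable {f : Fin n → Fin S} {b : Fin S → ℝ} {δ : Fin S → Fin A → ℝ} {Δ : ℝ}
  (h : TiltBounds f b δ Δ)

include h

theorem n_cast_pos : (0 : ℝ) < n := by exact_mod_cast h.n_pos

theorem meanLabel_mem : meanLabel f b ∈ Set.Icc (0 : ℝ) 1 := by
  have hn := h.n_cast_pos
  refine ⟨mul_nonneg (by positivity) (Finset.sum_nonneg fun x _ => (h.b_mem _).1), ?_⟩
  have : ∑ x, b (f x) ≤ ∑ _x : Fin n, (1 : ℝ) := Finset.sum_le_sum fun x _ => (h.b_mem _).2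
  simp only [Finset.sum_const, Finset.card_univ, Fintype.card_fin, nsmul_eq_mul, mul_one] at this
  rw [meanLabel, one_div, inv_mul_le_iff₀ hn]
  simpa using this

theorem abs_label_sub_le (s : Fin S) : |b s - meanLabel f b| ≤ 1 := by
  have h1 := h.b_mem s
  have h2 := h.meanLabel_mem
  rw [abs_le]
  constructor <;> linarith [h1.1, h1.2, h2.1, h2.2]

theorem abs_mul_le {D : ℝ} (hD : |D| ≤ Δ) (s : Fin S) : |D * (b s - meanLabel f b)| ≤ Δ := by
  rw [abs_mul]
  calc _ ≤ |D| * 1 := mul_le_mul_of_nonneg_left (h.abs_label_sub_le s) (abs_nonneg _)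
    _ ≤ Δ := by rwa [mul_one]

theorem tilt_bounds {D : ℝ} (hD : |D| ≤ Δ) (s : Fin S) :
    1 - Δ ≤ 1 + D * (b s - meanLabel f b) ∧ 1 + D * (b s - meanLabel f b) ≤ 1 + Δ := by
  have := abs_le.mp (h.abs_mul_le hD s)
  constructor <;> linarith

/-- The cluster size in the latent transition cancels against the uniform emission, and the action
enters through a scalar only. -/
theorem ker_eq (x : Fin n) (a : Fin A) (y : Fin n) :
    (tiltedModel f b δ).ker x a y
      = 1 / (n : ℝ) * (1 + δ (f x) a * (b (f y) - meanLabel f b)) := by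
  have := (h.size_pos (f y)).ne'
  have := h.n_cast_pos.ne'
  simp only [BMDP.ker, tiltedModel, if_true]
  field_simp

theorem ker_bounds (x : Fin n) (a : Fin A) (y : Fin n) :
    1 / (2 * n) ≤ (tiltedModel f b δ).ker x a y ∧ (tiltedModel f b δ).ker x a y ≤ 2 / n := by
  have hn := h.n_cast_pos
  obtain ⟨h1, h2⟩ := h.tilt_bounds (h.abs_tilt_le (f x) a) (f y)
  have h3 := h.bound_le
  rw [h.ker_eq]
  constructor
  · calc 1 / (2 * (n : ℝ)) = 1 / n * (1 / 2) := by field_simp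
      _ ≤ _ := mul_le_mul_of_nonneg_left (by linarith) (by positivity)
  · calc _ ≤ 1 / (n : ℝ) * 2 := mul_le_mul_of_nonneg_left (by linarith) (by positivity)
      _ = 2 / n := by ring

theorem wellDefined : (tiltedModel f b δ).WellDefined where
  μ_mem := by
    have hn := h.n_cast_pos
    refine ⟨fun x => ?_, ?_⟩ <;> simp only [tiltedModel]
    · positivity
    · simp [hn.ne']
  p_mem s a := by
    have hn := h.n_cast_pos
    refine ⟨fun s' => ?_, ?_⟩
    · have := (h.tilt_bounds (h.abs_tilt_le s a) s').1
      have := h.bound_le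
      exact mul_nonneg (div_nonneg (h.size_pos s').le hn.le) (by linarith)
    · rw [← sum_centred h.n_pos f b (δ s a), ← sum_clusterSize_mul f
        (fun s' => 1 / (n : ℝ) * (1 + δ s a * (b s' - meanLabel f b)))]
      refine Finset.sum_congr rfl fun s' _ => ?_
      simp only [tiltedModel]
      ring
  q_mem s := by
    refine ⟨fun x => ?_, ?_⟩ <;> simp only [tiltedModel]
    · have := h.size_pos s
      split_ifs <;> positivity
    · rw [← Finset.sum_filter, Finset.sum_const, nsmul_eq_mul]
      change clusterSize f s * _ = 1
      have := (h.size_pos s).ne'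
      field_simp
  q_support s := by
    ext x
    have := (h.size_pos s).ne'
    by_cases hx : f x = s <;> simp [tiltedModel, hx, this]

omit h in
theorem uniformStart : (tiltedModel f b δ).UniformStart := fun _ => rfl

theorem positive : (tiltedModel f b δ).Positive where
  sum_μ := h.wellDefined.μ_mem.2
  sum_ker x a := by
    simp_rw [h.ker_eq]
    exact sum_centred h.n_pos f b _
  uniform := uniformStart
  ker_pos x a y := by
    have := h.n_cast_pos
    exact lt_of_lt_of_le (by positivity) (h.ker_bounds x a y).1

/-- The worst ratio is that of outgoing probabilities: `1 + Δ` from the cluster sizes times `(1 +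
Δ)/(1 - Δ)` from the tilts. This is the hypothesis on `η`. -/
theorem regular {η : ℝ} (hη : (1 + Δ) ^ 2 ≤ η * (1 - Δ)) (hΔ : 0 ≤ Δ)
    (hsize : ∀ s s', clusterSize f s ≤ (1 + Δ) * clusterSize f s') :
    (tiltedModel f b δ).Regular η := by
  have hn := h.n_cast_pos
  have hΔ' := h.bound_le
  have hη1 : 1 + Δ ≤ η := by nlinarith
  have hη2 : 1 + Δ ≤ η * (1 - Δ) := by nlinarith
  refine ⟨fun s => div_pos (h.size_pos s) hn, fun s₁ s₂ => ?_, fun a s₁ s₂ s₃ => ?_,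
    fun a s₁ s₂ s₃ => ?_, fun s x y hx hy => ?_⟩
  · change clusterSize f s₁ / n ≤ η * (clusterSize f s₂ / n)
    rw [← mul_div_assoc]
    gcongr
    exact (hsize s₁ s₂).trans (mul_le_mul_of_nonneg_right hη1 (h.size_pos s₂).le)
  · have h2 := h.tilt_bounds (h.abs_tilt_le s₁ a) s₂
    have h3 := h.tilt_bounds (h.abs_tilt_le s₁ a) s₃
    simp only [tiltedModel]
    have hs2 := h.size_pos s₂
    have hs3 := h.size_pos s₃
    calc clusterSize f s₂ / n * (1 + δ s₁ a * (b s₂ - meanLabel f b))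
        ≤ (1 + Δ) * clusterSize f s₃ / n * (1 + Δ) := by
          gcongr
          · linarith
          · exact hsize _ _
          · linarith [h2.2]
      _ = clusterSize f s₃ / n * (1 + Δ) ^ 2 := by ring
      _ ≤ clusterSize f s₃ / n * (η * (1 + δ s₁ a * (b s₃ - meanLabel f b))) := by
          gcongr
          exact hη.trans (mul_le_mul_of_nonneg_left h3.1 (by linarith))
      _ = _ := by ring
  · have h2 := h.tilt_bounds (h.abs_tilt_le s₂ a) s₁
    have h3 := h.tilt_bounds (h.abs_tilt_le s₃ a) s₁
    have hs1 := h.size_pos s₁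
    simp only [tiltedModel]
    calc clusterSize f s₁ / n * (1 + δ s₂ a * (b s₁ - meanLabel f b))
        ≤ clusterSize f s₁ / n * (η * (1 + δ s₃ a * (b s₁ - meanLabel f b))) := by
          gcongr
          exact h2.2.trans (hη2.trans (mul_le_mul_of_nonneg_left h3.1 (by linarith)))
      _ = _ := by ring
  · simp only [tiltedModel] at hx hy ⊢
    rw [if_pos hx, if_pos hy]
    have := h.size_pos s
    exact le_mul_of_one_le_left (by positivity) (by linarith)

/-- Different tilts give different rows at any state whose label is not the mean. -/
theorem separable {η : ℝ} (hN : 1 ≤ N) (hη : 0 < η) (reg : (tiltedModel f b δ).Regular η)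
    {s₀ : Fin S} (hs₀ : b s₀ ≠ meanLabel f b)
    (rows : ∀ i j, i ≠ j → ∃ a, δ j a ≠ δ i a) :
    (tiltedModel f b δ).Separable (N + 1) η := by
  refine BMDP.separable_of_rows_ne (by omega) hη h.wellDefined reg uniformStart
    fun i j hij => ?_
  obtain ⟨a, ha⟩ := rows i j hij
  refine ⟨a, s₀, fun heq => ha ?_⟩
  have h1 : clusterSize f s₀ / n ≠ 0 := (div_pos (h.size_pos s₀) h.n_cast_pos).ne'
  simp only [tiltedModel] at heq
  exact mul_right_cancel₀ (sub_ne_zero.mpr hs₀) (add_left_cancel (mul_left_cancel₀ h1 heq))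

end TiltBounds

/-- Expected tilt chosen by the policy `π` in round `k + 1`. -/
def meanTilt (f : Fin n → Fin S) (b : Fin S → ℝ) (δ : Fin S → Fin A → ℝ)
    (π : Policy n A (N + 1)) (k : Fin N) : ℝ :=
  ∑ x, ∑ a, (tiltedModel f b δ).ctxLaw π k x * π.1 k.castSucc x a * δ (f x) a

/-- The state-dependent reward `w`, in every round. -/
def ctxReward (A N : ℕ) (w : Fin n → ℝ) : Reward n A (N + 1) := fun _ x _ => w x

/-- The covariance of the label and the reward under the uniform law. -/
def labelCov (f : Fin n → Fin S) (b : Fin S → ℝ) (w : Fin n → ℝ) : ℝ :=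
  1 / (n : ℝ) * ∑ x, (b (f x) - meanLabel f b) * w x

/-- The policy that plays `o (f x)` in context `x`. -/
def labelPolicy (N : ℕ) (f : Fin n → Fin S) (o : Fin S → Fin A) : Policy n A (N + 1) :=
  ⟨fun _ x a => if a = o (f x) then 1 else 0, fun _ x =>
    ⟨fun a => by dsimp only; split_ifs <;> norm_num, by simp⟩⟩

/-- Average over the first `N` rounds of the probability of action `a` in context `x`. -/
def Policy.avg (π : Policy n A (N + 1)) (x : Fin n) (a : Fin A) : ℝ :=
  1 / (N : ℝ) * ∑ k : Fin N, π.1 k.castSucc x a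

/-- Mean of `Policy.avg` over the random output of the algorithm. -/
def Algorithm.meanOutput (alg : Algorithm n A (N + 1) T) (r : Reward n A (N + 1))
    (d : Data n A (N + 1) T) (x : Fin n) (a : Fin A) : ℝ :=
  ∫ π, π.avg x a ∂(alg.output r d)

theorem Policy.apply_mem (π : Policy n A (N + 1)) (k : Fin (N + 1)) (x : Fin n) (a : Fin A) :
    π.1 k x a ∈ Set.Icc (0 : ℝ) 1 :=
  ⟨(π.2 k x).1 a, le_one_of_mem_stdSimplex (π.2 k x) a⟩

theorem Policy.measurable_apply {H : ℕ} (k : Fin H) (x : Fin n) (a : Fin A) :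
    Measurable fun π : Policy n A H => π.1 k x a :=
  (measurable_pi_apply a).comp ((measurable_pi_apply x).comp
    ((measurable_pi_apply k).comp measurable_subtype_coe))

theorem BMDP.measurable_ctxLaw {H : ℕ} (Φ : BMDP S n A) (k : ℕ) (x : Fin n) :
    Measurable fun π : Policy n A H => Φ.ctxLaw π k x := by
  induction k generalizing x with
  | zero => exact measurable_const
  | succ k ih =>
    simp only [BMDP.ctxLaw]
    split_ifs with hk
    · exact Finset.measurable_sum _ fun z _ => Finset.measurable_sum _ fun a _ =>
        ((ih z).mul (Policy.measurable_apply ⟨k, hk⟩ z a)).mul_const _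
    · exact measurable_const

theorem BMDP.measurable_value {H : ℕ} (Φ : BMDP S n A) (r : Reward n A H) :
    Measurable fun π : Policy n A H => Φ.value r π := by
  unfold BMDP.value
  exact Finset.measurable_sum _ fun h _ => Finset.measurable_sum _ fun x _ =>
    Finset.measurable_sum _ fun a _ =>
      ((Φ.measurable_ctxLaw h x).mul (Policy.measurable_apply h x a)).mul_const _

theorem Policy.avg_mem (π : Policy n A (N + 1)) (x : Fin n) (a : Fin A) :
    π.avg x a ∈ Set.Icc (0 : ℝ) 1 := by
  refine ⟨mul_nonneg (by positivity) (Finset.sum_nonneg fun k _ => (π.apply_mem _ x a).1), ?_⟩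
  have : ∑ k : Fin N, π.1 k.castSucc x a ≤ ∑ _k : Fin N, (1 : ℝ) :=
    Finset.sum_le_sum fun k _ => (π.apply_mem _ x a).2
  simp only [Finset.sum_const, Finset.card_univ, Fintype.card_fin, nsmul_eq_mul, mul_one] at this
  unfold Policy.avg
  rcases Nat.eq_zero_or_pos N with rfl | hN
  · simp
  · have hN' : (0 : ℝ) < N := by exact_mod_cast hN
    rw [one_div, inv_mul_le_iff₀ hN']
    simpa using this

theorem Policy.sum_avg (hN : 1 ≤ N) (π : Policy n A (N + 1)) (x : Fin n) :
    ∑ a, π.avg x a = 1 := by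
  have hN' : (0 : ℝ) < N := by exact_mod_cast hN
  unfold Policy.avg
  rw [← Finset.mul_sum, Finset.sum_comm]
  simp_rw [(π.2 _ x).2]
  simp [hN'.ne']

theorem Policy.measurable_avg (x : Fin n) (a : Fin A) :
    Measurable fun π : Policy n A (N + 1) => π.avg x a :=
  (Finset.measurable_sum _ fun _ _ => Policy.measurable_apply _ x a).const_mul _

theorem Policy.integrable_avg (ν : Measure (Policy n A (N + 1))) [IsProbabilityMeasure ν]
    (x : Fin n) (a : Fin A) : Integrable (fun π : Policy n A (N + 1) => π.avg x a) ν :=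
  Integrable.of_bound (Policy.measurable_avg x a).aestronglyMeasurable 1
    (Eventually.of_forall fun π => by
      rw [Real.norm_of_nonneg (π.avg_mem x a).1]; exact (π.avg_mem x a).2)

theorem Algorithm.meanOutput_mem (alg : Algorithm n A (N + 1) T) (r : Reward n A (N + 1))
    (d : Data n A (N + 1) T) (x : Fin n) (a : Fin A) :
    alg.meanOutput r d x a ∈ Set.Icc (0 : ℝ) 1 := by
  have := alg.output_prob r d
  refine ⟨integral_nonneg fun π => (π.avg_mem x a).1, ?_⟩
  calc _ ≤ ∫ _π, (1 : ℝ) ∂(alg.output r d) :=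
        integral_mono (Policy.integrable_avg _ x a) (integrable_const _)
          fun π => (π.avg_mem x a).2
    _ = 1 := by simp

theorem Algorithm.sum_meanOutput (hN : 1 ≤ N) (alg : Algorithm n A (N + 1) T)
    (r : Reward n A (N + 1)) (d : Data n A (N + 1) T) (x : Fin n) :
    ∑ a, alg.meanOutput r d x a = 1 := by
  have := alg.output_prob r d
  unfold Algorithm.meanOutput
  rw [← integral_finsetSum _ fun a _ => Policy.integrable_avg _ x a]
  simp_rw [Policy.sum_avg hN]
  simp

/-! ### Value and regret in tilted models. -/

namespace TiltBounds

variable {f : Fin n → Fin S} {b : Fin S → ℝ} {δ : Fin S → Fin A → ℝ} {Δ : ℝ}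
  (h : TiltBounds f b δ Δ)

include h

omit h in
theorem sum_sum_ctxLaw (π : Policy n A (N + 1)) (k : Fin N)
    (hk : ∑ x, (tiltedModel f b δ).ctxLaw π k x = 1) :
    ∑ x, ∑ a, (tiltedModel f b δ).ctxLaw π k x * π.1 k.castSucc x a = 1 := by
  simp_rw [← Finset.mul_sum, (π.2 _ _).2, mul_one]
  exact hk

/-- Averaging an affine function of the tilt replaces the tilt by its mean. The total mass is a
hypothesis since `sum_ctxLaw` obtains it by induction through this formula. -/
theorem ctxLaw_succ_eq (π : Policy n A (N + 1)) (k : Fin N)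
    (hk : ∑ x, (tiltedModel f b δ).ctxLaw π k x = 1) (y : Fin n) :
    (tiltedModel f b δ).ctxLaw π (k + 1) y
      = 1 / (n : ℝ) * (1 + meanTilt f b δ π k * (b (f y) - meanLabel f b)) := by
  simp only [BMDP.ctxLaw]
  rw [dif_pos (show (k : ℕ) < N + 1 by omega)]
  simp_rw [h.ker_eq]
  have h1 := sum_sum_ctxLaw π k hk
  have e : 1 / (n : ℝ) * (1 + meanTilt f b δ π k * (b (f y) - meanLabel f b))
      = 1 / (n : ℝ) * (∑ x, ∑ a, (tiltedModel f b δ).ctxLaw π k x * π.1 k.castSucc x a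
        + meanTilt f b δ π k * (b (f y) - meanLabel f b)) := by rw [h1]
  rw [e, meanTilt, Finset.sum_mul, ← Finset.sum_add_distrib, Finset.mul_sum]
  refine Finset.sum_congr rfl fun x _ => ?_
  rw [Finset.sum_mul, ← Finset.sum_add_distrib, Finset.mul_sum]
  refine Finset.sum_congr rfl fun a _ => ?_
  change _ * π.1 k.castSucc x a * _ = _
  ring

theorem sum_ctxLaw (π : Policy n A (N + 1)) (k : ℕ) (hk : k ≤ N) :
    ∑ x, (tiltedModel f b δ).ctxLaw π k x = 1 := by
  induction k with
  | zero => exact h.wellDefined.μ_mem.2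
  | succ k ih =>
    have := h.ctxLaw_succ_eq π ⟨k, by omega⟩ (ih (by omega))
    simp only at this
    simp_rw [this]
    exact sum_centred h.n_pos f b _

theorem ctxLaw_succ (π : Policy n A (N + 1)) (k : Fin N) (y : Fin n) :
    (tiltedModel f b δ).ctxLaw π (k + 1) y
      = 1 / (n : ℝ) * (1 + meanTilt f b δ π k * (b (f y) - meanLabel f b)) :=
  h.ctxLaw_succ_eq π k (h.sum_ctxLaw π k k.is_lt.le) y

theorem abs_meanTilt_le (π : Policy n A (N + 1)) (k : Fin N) : |meanTilt f b δ π k| ≤ Δ := by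
  have hnn : ∀ x a, 0 ≤ (tiltedModel f b δ).ctxLaw π k x * π.1 k.castSucc x a := fun x a =>
    mul_nonneg (h.wellDefined.ctxLaw_nonneg π _ x) (π.apply_mem _ x a).1
  calc |meanTilt f b δ π k|
      ≤ ∑ x, ∑ a, (tiltedModel f b δ).ctxLaw π k x * π.1 k.castSucc x a * Δ := by
        refine (Finset.abs_sum_le_sum_abs _ _).trans (Finset.sum_le_sum fun x _ => ?_)
        refine (Finset.abs_sum_le_sum_abs _ _).trans (Finset.sum_le_sum fun a _ => ?_)
        rw [abs_mul, abs_of_nonneg (hnn x a)]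
        exact mul_le_mul_of_nonneg_left (h.abs_tilt_le _ _) (hnn x a)
    _ = Δ := by
        simp_rw [← Finset.sum_mul]
        rw [sum_sum_ctxLaw π k (h.sum_ctxLaw π k k.is_lt.le), one_mul]

/-- No policy can avoid a context, so a mistake in any context is paid for. -/
theorem ctxLaw_ge (π : Policy n A (N + 1)) (k : ℕ) (hk : k ≤ N) (x : Fin n) :
    1 / (2 * n) ≤ (tiltedModel f b δ).ctxLaw π k x := by
  have hn := h.n_cast_pos
  cases k with
  | zero =>
    change _ ≤ 1 / (n : ℝ)
    gcongr
    linarith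
  | succ k =>
    have := h.ctxLaw_succ π ⟨k, by omega⟩ x
    simp only at this
    rw [this]
    have h1 := (h.tilt_bounds (h.abs_meanTilt_le π ⟨k, by omega⟩) (f x)).1
    have h3 := h.bound_le
    calc 1 / (2 * (n : ℝ)) = 1 / n * (1 / 2) := by field_simp
      _ ≤ _ := mul_le_mul_of_nonneg_left (by linarith) (by positivity)

/-- The first round has the uniform law; each of the `N` later ones adds the covariance times the
mean tilt of the round before. -/
theorem value_eq (π : Policy n A (N + 1)) (w : Fin n → ℝ) :
    (tiltedModel f b δ).value (ctxReward A N w) π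
      = (N + 1) * (1 / (n : ℝ) * ∑ x, w x)
        + labelCov f b w * ∑ k : Fin N, meanTilt f b δ π k := by
  have h1 : ∀ k : Fin (N + 1), ∑ x, ∑ a, (tiltedModel f b δ).ctxLaw π k x * π.1 k x a *
      ctxReward A N w k x a = ∑ x, (tiltedModel f b δ).ctxLaw π k x * w x := by
    intro k
    refine Finset.sum_congr rfl fun x _ => ?_
    simp only [ctxReward]
    rw [← Finset.sum_mul, ← Finset.mul_sum, (π.2 _ _).2, mul_one]
  have h2 : ∀ k : Fin N, ∑ x, (tiltedModel f b δ).ctxLaw π (k + 1) x * w x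
      = 1 / (n : ℝ) * ∑ x, w x + labelCov f b w * meanTilt f b δ π k := by
    intro k
    simp_rw [h.ctxLaw_succ π k, labelCov, Finset.mul_sum, Finset.sum_mul,
      ← Finset.sum_add_distrib]
    exact Finset.sum_congr rfl fun x _ => by ring
  unfold BMDP.value
  simp_rw [h1]
  rw [Fin.sum_univ_succ]
  simp only [Fin.val_succ, h2, Finset.sum_add_distrib, ← Finset.mul_sum]
  simp only [Fin.val_zero, BMDP.ctxLaw, tiltedModel, Finset.sum_const, Finset.card_univ,
    Fintype.card_fin, nsmul_eq_mul]
  rw [← Finset.mul_sum]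
  ring

theorem meanTilt_labelPolicy {o : Fin S → Fin A} (ho : ∀ s, δ s (o s) = Δ) (k : Fin N) :
    meanTilt f b δ (labelPolicy N f o) k = Δ := by
  have : ∀ x, ∑ a, (tiltedModel f b δ).ctxLaw (labelPolicy N f o) k x *
      (labelPolicy N f o).1 k.castSucc x a * δ (f x) a
      = (tiltedModel f b δ).ctxLaw (labelPolicy N f o) k x * Δ := by
    intro x
    simp [labelPolicy, ho]
  unfold meanTilt
  simp_rw [this]
  rw [← Finset.sum_mul, h.sum_ctxLaw _ k k.is_lt.le, one_mul]

/-- A wrong action loses at least `Δ` of tilt, and every context has mass at least `1/(2n)`. -/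
theorem sub_meanTilt_ge (hΔ : 0 ≤ Δ) {o : Fin S → Fin A} (ho : ∀ s, δ s (o s) = Δ)
    (ho' : ∀ s a, a ≠ o s → δ s a ≤ 0) (π : Policy n A (N + 1)) (k : Fin N) :
    Δ / (2 * n) * ∑ x, (1 - π.1 k.castSucc x (o (f x))) ≤ Δ - meanTilt f b δ π k := by
  have hs := sum_sum_ctxLaw π k (h.sum_ctxLaw π k k.is_lt.le)
  have e : Δ - meanTilt f b δ π k = ∑ x, (tiltedModel f b δ).ctxLaw π k x *
      ∑ a, π.1 k.castSucc x a * (Δ - δ (f x) a) := by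
    rw [show Δ - meanTilt f b δ π k = (∑ x, ∑ a, (tiltedModel f b δ).ctxLaw π k x *
      π.1 k.castSucc x a) * Δ - meanTilt f b δ π k by rw [hs, one_mul], meanTilt,
      Finset.sum_mul, ← Finset.sum_sub_distrib]
    refine Finset.sum_congr rfl fun x _ => ?_
    rw [Finset.sum_mul, ← Finset.sum_sub_distrib, Finset.mul_sum]
    exact Finset.sum_congr rfl fun a _ => by ring
  rw [e, Finset.mul_sum]
  refine Finset.sum_le_sum fun x _ => ?_
  have h1 : (1 - π.1 k.castSucc x (o (f x))) * Δ
      ≤ ∑ a, π.1 k.castSucc x a * (Δ - δ (f x) a) := by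
    rw [← (π.2 k.castSucc x).2, ← Finset.sum_erase_eq_sub (Finset.mem_univ _),
      ← Finset.add_sum_erase Finset.univ _ (Finset.mem_univ (o (f x))), ho, sub_self, mul_zero,
      zero_add, Finset.sum_mul]
    refine Finset.sum_le_sum fun a ha => mul_le_mul_of_nonneg_left ?_ (π.apply_mem _ x a).1
    have := ho' (f x) a (Finset.ne_of_mem_erase ha)
    linarith
  have h2 : 0 ≤ (1 - π.1 k.castSucc x (o (f x))) * Δ :=
    mul_nonneg (sub_nonneg.mpr (π.apply_mem _ x _).2) hΔ
  calc _ = 1 / (2 * n) * ((1 - π.1 k.castSucc x (o (f x))) * Δ) := by ring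
    _ ≤ _ := mul_le_mul (h.ctxLaw_ge π k k.is_lt.le x) h1 h2
        (h.wellDefined.ctxLaw_nonneg π k x)

theorem value_le (π : Policy n A (N + 1)) {w : Fin n → ℝ} (hw : 0 ≤ labelCov f b w)
    {o : Fin S → Fin A} (ho : ∀ s, δ s (o s) = Δ) :
    (tiltedModel f b δ).value (ctxReward A N w) π
      ≤ (tiltedModel f b δ).value (ctxReward A N w) (labelPolicy N f o) := by
  rw [h.value_eq, h.value_eq]
  gcongr with k
  rw [h.meanTilt_labelPolicy ho]
  exact (abs_le.mp (h.abs_meanTilt_le π k)).2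

theorem regret_ge (hN : 1 ≤ N) (hΔ : 0 ≤ Δ) {w : Fin n → ℝ} (hw : 0 ≤ labelCov f b w)
    {o : Fin S → Fin A} (ho : ∀ s, δ s (o s) = Δ) (ho' : ∀ s a, a ≠ o s → δ s a ≤ 0)
    (π : Policy n A (N + 1)) :
    labelCov f b w * Δ / (4 * n) * ∑ x, (1 - π.avg x (o (f x)))
      ≤ 1 / ((N + 1 : ℕ) : ℝ) * ((tiltedModel f b δ).optValue (ctxReward A N w)
          - (tiltedModel f b δ).value (ctxReward A N w) π) := by
  have hN' : (1 : ℝ) ≤ N := by exact_mod_cast hN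
  have hn := h.n_cast_pos
  have hopt : (tiltedModel f b δ).value (ctxReward A N w) (labelPolicy N f o)
      ≤ (tiltedModel f b δ).optValue (ctxReward A N w) :=
    le_ciSup (f := fun π => (tiltedModel f b δ).value (ctxReward A N w) π)
      ⟨_, by rintro _ ⟨π, rfl⟩; exact h.value_le π hw ho⟩ (labelPolicy N f o)
  have hdiff : labelCov f b w * ∑ k : Fin N,
      (Δ / (2 * n) * ∑ x, (1 - π.1 k.castSucc x (o (f x))))
      ≤ (tiltedModel f b δ).value (ctxReward A N w) (labelPolicy N f o)
        - (tiltedModel f b δ).value (ctxReward A N w) π := by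
    rw [h.value_eq, h.value_eq, add_sub_add_left_eq_sub, ← mul_sub, ← Finset.sum_sub_distrib]
    gcongr with k
    rw [h.meanTilt_labelPolicy ho]
    exact h.sub_meanTilt_ge hΔ ho ho' π k
  have havg : ∑ k : Fin N, (Δ / (2 * n) * ∑ x, (1 - π.1 k.castSucc x (o (f x))))
      = N * (Δ / (2 * n) * ∑ x, (1 - π.avg x (o (f x)))) := by
    rw [← Finset.mul_sum, Finset.sum_comm]
    have : ∀ x, ∑ k : Fin N, (1 - π.1 k.castSucc x (o (f x)))
        = N * (1 - π.avg x (o (f x))) := by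
      intro x
      simp only [Policy.avg, Finset.sum_sub_distrib, Finset.sum_const, Finset.card_univ,
        Fintype.card_fin, nsmul_eq_mul]
      field_simp
    simp_rw [this, ← Finset.mul_sum]
    ring
  have hnn : 0 ≤ ∑ x, (1 - π.avg x (o (f x))) :=
    Finset.sum_nonneg fun x _ => sub_nonneg.mpr (π.avg_mem x _).2
  rw [havg] at hdiff
  have hfin := hdiff.trans (sub_le_sub_right hopt _)
  refine le_trans ?_ (mul_le_mul_of_nonneg_left hfin (by positivity))
  push_cast
  -- Only `N` of the `N + 1` rounds have a reward that depends on the policy; `N ≥ 1` makes this at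
  -- least half.
  have hfrac : 1 / 2 ≤ 1 / ((N : ℝ) + 1) * N := by
    rw [one_div_mul_eq_div, div_le_div_iff₀ (by norm_num) (by linarith)]
    linarith
  calc _ = 1 / 2 * (labelCov f b w * (Δ / (2 * n) * ∑ x, (1 - π.avg x (o (f x))))) := by
        ring
    _ ≤ 1 / ((N : ℝ) + 1) * N * (labelCov f b w * (Δ / (2 * n) *
          ∑ x, (1 - π.avg x (o (f x))))) :=
        mul_le_mul_of_nonneg_right hfrac (by positivity)
    _ = _ := by ring

/-- The regret bound is affine in `Policy.avg`, so a random output enters only through its mean. -/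
theorem expectedLoss_ge (hN : 1 ≤ N) (hΔ : 0 ≤ Δ) {w : Fin n → ℝ} (hw : 0 ≤ labelCov f b w)
    {o : Fin S → Fin A} (ho : ∀ s, δ s (o s) = Δ) (ho' : ∀ s a, a ≠ o s → δ s a ≤ 0)
    (alg : Algorithm n A (N + 1) T) :
    labelCov f b w * Δ / (4 * n) * ∑ x, ∑ d, alg.dataProb (tiltedModel f b δ) (ctxReward A N w) d
        * (1 - alg.meanOutput (ctxReward A N w) d x (o (f x)))
      ≤ alg.expectedLoss (tiltedModel f b δ) (ctxReward A N w) := by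
  unfold Algorithm.expectedLoss
  rw [Finset.sum_comm, Finset.mul_sum]
  refine Finset.sum_le_sum fun d _ => ?_
  have hν := alg.output_prob (ctxReward A N w) d
  set ν := alg.output (ctxReward A N w) d
  rw [← Finset.mul_sum, mul_left_comm]
  refine mul_le_mul_of_nonneg_left ?_ (h.positive.dataProb_nonneg alg _ d)
  have hint : ∀ x, Integrable (fun π : Policy n A (N + 1) => 1 - π.avg x (o (f x))) ν := fun x =>
    (integrable_const _).sub (Policy.integrable_avg ν x _)
  have e : ∫ π : Policy n A (N + 1), labelCov f b w * Δ / (4 * n) *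
      ∑ x, (1 - π.avg x (o (f x))) ∂ν = labelCov f b w * Δ / (4 * n) *
      ∑ x, (1 - alg.meanOutput (ctxReward A N w) d x (o (f x))) := by
    rw [integral_const_mul, integral_finsetSum _ fun x _ => hint x]
    congr 1
    refine Finset.sum_congr rfl fun x _ => ?_
    rw [integral_sub (integrable_const _) (Policy.integrable_avg ν x _)]
    simp [Algorithm.meanOutput, ν]
  rw [← e]
  refine integral_mono ((integrable_finsetSum _ fun x _ => hint x).const_mul _) ?_
    fun π => h.regret_ge hN hΔ hw ho ho' π
  -- Integrability of the value is essential: otherwise the integral would be `0` by convention. The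
  -- formula for the value provides a uniform bound.
  refine ((integrable_const _).sub (Integrable.of_bound
    (BMDP.measurable_value _ _).aestronglyMeasurable
    (|(N + 1) * (1 / (n : ℝ) * ∑ x, w x)| + labelCov f b w * (N * Δ))
    (Eventually.of_forall fun π => ?_))).const_mul _
  rw [h.value_eq]
  refine (norm_add_le _ _).trans ?_
  rw [Real.norm_eq_abs, Real.norm_eq_abs, abs_mul (labelCov f b w), abs_of_nonneg hw]
  gcongr
  refine (Finset.abs_sum_le_sum_abs _ _).trans
    ((Finset.sum_le_sum fun k _ => h.abs_meanTilt_le π k).trans ?_)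
  simp

end TiltBounds

end BlockMDP

end

/-! ### Balanced decoding functions and the hard instances. -/

noncomputable section

namespace BlockMDP

variable {S n A N T : ℕ}

/-- The decoding function that permutes the residues modulo `S` in every block of `S`
consecutive contexts. -/
def blockLabel [NeZero S] (n : ℕ) (σ : ℕ → Equiv.Perm (Fin S)) (x : Fin n) : Fin S :=
  σ (x / S) ⟨x % S, Nat.mod_lt _ (NeZero.pos S)⟩

/-- Each block holds a state at most once, and there are at most `n / S + 1` blocks, the last one
possibly incomplete. -/
theorem clusterSize_blockLabel_le [NeZero S] (σ : ℕ → Equiv.Perm (Fin S)) (s : Fin S) :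
    clusterSize (blockLabel n σ) s ≤ (n / S : ℕ) + 1 := by
  unfold clusterSize
  have : (Finset.univ.filter fun x => blockLabel n σ x = s).card
      ≤ (Finset.range (n / S + 1)).card := by
    refine Finset.card_le_card_of_injOn (fun x => (x : ℕ) / S) ?_ ?_
    · intro x _
      simp only [Finset.coe_range, Set.mem_Iio, Nat.lt_succ_iff]
      exact Nat.div_le_div_right x.is_lt.le
    · intro x hx y hy hxy
      have hx' : blockLabel n σ x = s := by simpa using hx
      have hy' : blockLabel n σ y = s := by simpa using hy
      simp only at hxy
      rw [← hy', blockLabel, blockLabel, hxy] at hx'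
      have hmod := congrArg Fin.val ((σ _).injective hx')
      simp only at hmod
      ext
      rw [← Nat.div_add_mod (x : ℕ) S, ← Nat.div_add_mod (y : ℕ) S, hxy, hmod]
  rw [Finset.card_range] at this
  exact_mod_cast this

/-- Each complete block holds every state. -/
theorem le_clusterSize_blockLabel [NeZero S] (σ : ℕ → Equiv.Perm (Fin S)) (s : Fin S) :
    ((n / S : ℕ) : ℝ) ≤ clusterSize (blockLabel n σ) s := by
  unfold clusterSize
  have : (Finset.range (n / S)).card
      ≤ (Finset.univ.filter fun x => blockLabel n σ x = s).card := by
    refine Finset.card_le_card_of_surjOn (fun x => (x : ℕ) / S) ?_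
    intro k hk
    simp only [Finset.coe_range, Set.mem_Iio] at hk
    have hr := ((σ k).symm s).is_lt
    have hlt : S * k + ((σ k).symm s : ℕ) < n := by
      have h1 : S * (k + 1) ≤ n := (Nat.mul_le_mul_left S hk).trans (Nat.mul_div_le n S)
      rw [mul_add, mul_one] at h1
      omega
    have hdiv : (S * k + ((σ k).symm s : ℕ)) / S = k := by
      rw [Nat.mul_add_div (NeZero.pos S), Nat.div_eq_of_lt hr, add_zero]
    refine ⟨⟨_, hlt⟩, ?_, hdiv⟩
    have : blockLabel n σ ⟨S * k + ((σ k).symm s : ℕ), hlt⟩ = s := by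
      simp only [blockLabel, hdiv, Nat.mul_add_mod, Nat.mod_eq_of_lt hr, Fin.eta,
        Equiv.apply_symm_apply]
    simpa using this
  rw [Finset.card_range] at this
  exact_mod_cast this

/-- The indicator of the first half of the latent states. -/
def topLabel (s : Fin S) : ℝ := if (s : ℕ) < S / 2 then 1 else 0

theorem topLabel_mem (s : Fin S) : topLabel s ∈ Set.Icc (0 : ℝ) 1 := by
  unfold topLabel
  split_ifs <;> simp

theorem topLabel_mul_self (s : Fin S) : topLabel s * topLabel s = topLabel s := by
  unfold topLabel
  split_ifs <;> simp

theorem sum_topLabel : ∑ s : Fin S, topLabel s = ((S / 2 : ℕ) : ℝ) := by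
  unfold topLabel
  rw [Fin.sum_univ_eq_sum_range (fun i => if i < S / 2 then (1 : ℝ) else 0) S,
    ← Finset.sum_filter, Finset.sum_const, nsmul_eq_mul, mul_one]
  congr 1
  have : (Finset.range S).filter (fun i => i < S / 2) = Finset.range (S / 2) := by
    ext i
    simp only [Finset.mem_filter, Finset.mem_range]
    omega
  rw [this, Finset.card_range]

/-- With `q = n / S ≥ 4`: `n < S (q + 1) ≤ 3 m (q + 1) ≤ 4 m q`. The case `S = 3`, `m = 1` is why
one third is used. -/
theorem four_mul_div_mul_ge {m : ℕ} (hm : S ≤ 3 * m) (hS : 0 < S) (hn : 4 * S ≤ n) :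
    n ≤ 4 * (n / S * m) := by
  have hq : 4 ≤ n / S := (Nat.le_div_iff_mul_le hS).mpr hn
  have h1 : n < S * (n / S + 1) := Nat.lt_mul_div_succ n hS
  nlinarith [Nat.mul_le_mul_right (n / S + 1) hm, Nat.mul_le_mul_right m hq]

/-- At least a third of the states carry each label value, and incomplete blocks cost the rest. This
keeps the covariance of label and reward away from zero. -/
theorem meanLabel_topLabel_mem [NeZero S] (hS : 2 ≤ S) (hn : 4 * S ≤ n)
    (σ : ℕ → Equiv.Perm (Fin S)) :
    meanLabel (blockLabel n σ) topLabel ∈ Set.Icc (1 / 4 : ℝ) (3 / 4) := by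
  have hn0 : (0 : ℝ) < n := by exact_mod_cast (by omega : 0 < n)
  have key : ∀ g : Fin S → ℝ, (∀ s, 0 ≤ g s) → ∀ m : ℕ, S ≤ 3 * m → ∑ s, g s = (m : ℝ) →
      (n : ℝ) / 4 ≤ ∑ x, g (blockLabel n σ x) := by
    intro g hg m hm hgm
    rw [← sum_clusterSize_mul]
    calc (n : ℝ) / 4 ≤ ((n / S : ℕ) : ℝ) * m := by
          have := four_mul_div_mul_ge hm (by omega) hn
          have : (n : ℝ) ≤ 4 * (((n / S : ℕ) : ℝ) * m) := by exact_mod_cast this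
          linarith
      _ = ∑ s, ((n / S : ℕ) : ℝ) * g s := by rw [← Finset.mul_sum, hgm]
      _ ≤ _ := Finset.sum_le_sum fun s _ =>
          mul_le_mul_of_nonneg_right (le_clusterSize_blockLabel σ s) (hg s)
  have h1 := key topLabel (fun s => (topLabel_mem s).1) (S / 2) (by omega) sum_topLabel
  have h2 := key (fun s => 1 - topLabel s) (fun s => sub_nonneg.mpr (topLabel_mem s).2)
    (S - S / 2) (by omega) (by
      rw [Finset.sum_sub_distrib, sum_topLabel, Nat.cast_sub (Nat.div_le_self _ _)]; simp)
  simp only [Finset.sum_sub_distrib, Finset.sum_const, Finset.card_univ, Fintype.card_fin,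
    nsmul_eq_mul, mul_one] at h2
  unfold meanLabel
  rw [one_div_mul_eq_div, Set.mem_Icc, le_div_iff₀ hn0, div_le_iff₀ hn0]
  constructor <;> linarith

/-- Action `o s` has tilt `Δ` in state `s`; the other actions have small nonpositive tilts which
depend on `s`. -/
def actionTilt (Δ : ℝ) (o : Fin S → Option (Fin A)) (s : Fin S) (a : Fin A) : ℝ :=
  if o s = some a then Δ else -(Δ * ((s : ℕ) / S))

theorem abs_actionTilt_le {Δ : ℝ} (hΔ : 0 ≤ Δ) (o : Fin S → Option (Fin A)) (s : Fin S)
    (a : Fin A) : |actionTilt Δ o s a| ≤ Δ := by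
  have hS : (0 : ℝ) < S := by exact_mod_cast s.pos
  have h1 : ((s : ℕ) : ℝ) / S ≤ 1 := by
    rw [div_le_one hS]
    exact_mod_cast s.is_lt.le
  unfold actionTilt
  split_ifs
  · rw [abs_of_nonneg hΔ]
  · rw [abs_neg, abs_of_nonneg (by positivity)]
    exact mul_le_of_le_one_right hΔ h1

theorem actionTilt_self (Δ : ℝ) (o : Fin S → Fin A) (s : Fin S) :
    actionTilt Δ (fun s => some (o s)) s (o s) = Δ := by simp [actionTilt]

theorem actionTilt_nonpos {Δ : ℝ} (hΔ : 0 ≤ Δ) (o : Fin S → Fin A) (s : Fin S) (a : Fin A)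
    (ha : a ≠ o s) : actionTilt Δ (fun s => some (o s)) s a ≤ 0 := by
  unfold actionTilt
  rw [if_neg (by simpa using ha.symm), neg_nonpos]
  positivity

/-- States with the same best action are separated by any other action, through the offset `s / S`;
otherwise the sign of the tilt separates them. -/
theorem exists_actionTilt_ne {Δ : ℝ} (hΔ : 0 < Δ) (hA : 2 ≤ A) (o : Fin S → Fin A)
    (i j : Fin S) (hij : i ≠ j) :
    ∃ a, actionTilt Δ (fun s => some (o s)) j a ≠ actionTilt Δ (fun s => some (o s)) i a := by
  have hS : (0 : ℝ) < S := by exact_mod_cast i.pos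
  by_cases h : o i = o j
  · have : Nontrivial (Fin A) := Fin.nontrivial_iff_two_le.mpr hA
    obtain ⟨a, ha⟩ := exists_ne (o i)
    refine ⟨a, fun heq => hij ?_⟩
    unfold actionTilt at heq
    rw [if_neg (by simpa [← h] using ha.symm), if_neg (by simpa using ha.symm),
      neg_inj] at heq
    have := mul_left_cancel₀ hΔ.ne' heq
    rw [div_left_inj' hS.ne'] at this
    exact (Fin.ext (by exact_mod_cast this)).symm
  · refine ⟨o j, fun heq => ?_⟩
    rw [actionTilt_self] at heq
    have := actionTilt_nonpos hΔ.le o i (o j) (Ne.symm h)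
    linarith

/-- When the tilt is of order `ε`, the cluster sizes are still balanced only up to a factor `1 + Δ₀`
with fixed `Δ₀`; regularity is checked at that coarser scale. -/
theorem TiltBounds.mono {f : Fin n → Fin S} {b : Fin S → ℝ} {δ : Fin S → Fin A → ℝ} {Δ Δ' : ℝ}
    (h : TiltBounds f b δ Δ) (hle : Δ ≤ Δ') (hΔ' : Δ' ≤ 1 / 2) : TiltBounds f b δ Δ' :=
  { h with abs_tilt_le := fun s a => (h.abs_tilt_le s a).trans hle, bound_le := hΔ' }

theorem tiltBounds_actionTilt [NeZero S] (hn : 4 * S ≤ n) (σ : ℕ → Equiv.Perm (Fin S)) {Δ : ℝ}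
    (hΔ : 0 ≤ Δ) (hΔ' : Δ ≤ 1 / 2) (o : Fin S → Option (Fin A)) :
    TiltBounds (blockLabel n σ) topLabel (actionTilt Δ o) Δ where
  n_pos := by have := NeZero.pos S; omega
  b_mem := topLabel_mem
  abs_tilt_le := abs_actionTilt_le hΔ o
  bound_le := hΔ'
  size_pos s := by
    refine lt_of_lt_of_le ?_ (le_clusterSize_blockLabel σ s)
    have hq : 4 ≤ n / S := (Nat.le_div_iff_mul_le (NeZero.pos S)).mpr hn
    exact_mod_cast (by omega : 0 < n / S)

/-- The class of tilted models with one best action in every state lies in the class of the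
theorem. -/
theorem Algorithm.Guarantee.expectedLoss_le [NeZero S] (hS : 2 ≤ S) (hA : 2 ≤ A)
    (hn : 4 * S ≤ n) (hN : 1 ≤ N) {η ε : ℝ} (σ : ℕ → Equiv.Perm (Fin S)) {Δ Δ₀ : ℝ} (hΔ : 0 < Δ)
    (hΔ₀ : Δ ≤ Δ₀) (hΔ₀' : Δ₀ ≤ 1 / 2) (hη : (1 + Δ₀) ^ 2 ≤ η * (1 - Δ₀))
    (hn' : 1 ≤ Δ₀ * (n / S : ℕ)) {alg : Algorithm n A (N + 1) T} (hg : alg.Guarantee S η ε)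
    (o : Fin S → Fin A) {w : Fin n → ℝ} (hw : ∀ x, w x ∈ Set.Icc (0 : ℝ) 1) :
    alg.expectedLoss (tiltedModel (blockLabel n σ) topLabel
      (actionTilt Δ fun s => some (o s))) (ctxReward A N w) ≤ ε := by
  have h := (tiltBounds_actionTilt hn σ hΔ.le (hΔ₀.trans hΔ₀') fun s => some (o s)).mono
    hΔ₀ hΔ₀'
  have hη0 : 0 < η := by nlinarith
  have reg := h.regular hη (hΔ.le.trans hΔ₀) fun s s' =>
    (clusterSize_blockLabel_le σ s).trans (by
      have := le_clusterSize_blockLabel (n := n) σ s'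
      nlinarith)
  refine hg _ h.wellDefined reg TiltBounds.uniformStart
    (h.separable hN hη0 reg (s₀ := ⟨0, by omega⟩) ?_ (exists_actionTilt_ne hΔ hA o)) _
    fun _ x _ => hw x
  have h1 := meanLabel_topLabel_mem hS hn σ
  have h2 : topLabel (⟨0, by omega⟩ : Fin S) = 1 := by
    unfold topLabel
    rw [if_pos (show 0 < S / 2 by omega)]
  rw [h2]
  intro h3
  linarith [h1.2]

end BlockMDP

end

/-! ### Lower bound for identifying the best actions. -/

noncomputable section

namespace BlockMDP

variable {S n A N T : ℕ}

theorem sq_sub_div_le {c e k₀ k₁ : ℝ} (hc : 0 < c) (hk : 1 / (2 * c) ≤ k₁)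
    (hd : |k₀ - k₁| ≤ e / c) : (k₀ - k₁) ^ 2 / k₁ ≤ 2 * e ^ 2 / c := by
  have hk₁ : 0 < k₁ := lt_of_lt_of_le (by positivity) hk
  rw [div_le_iff₀ hk₁]
  have h1 : (k₀ - k₁) ^ 2 ≤ (e / c) ^ 2 := by
    rw [← sq_abs]
    exact pow_le_pow_left₀ (abs_nonneg _) hd 2
  calc _ ≤ (e / c) ^ 2 := h1
    _ = 2 * e ^ 2 / c * (1 / (2 * c)) := by field_simp
    _ ≤ _ := mul_le_mul_of_nonneg_left hk (by positivity)

section Comparison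

variable [Nonempty (Fin n × Fin A)] (alg : Algorithm n A (N + 1) T) (r : Reward n A (N + 1))
  {Φ₀ Φ₁ : BMDP S n A}

theorem Algorithm.sum_dataProb_mul_le_add (h₀ : Φ₀.Positive) (h₁ : Φ₁.Positive)
    {D : Fin n × Fin A → ℝ}
    (hD : ∀ z, ∑ y, (Φ₀.ker z.1 z.2 y - Φ₁.ker z.1 z.2 y) ^ 2 / Φ₁.ker z.1 z.2 y ≤ D z)
    {g : Data n A (N + 1) T → ℝ} (hg : ∀ d, g d ∈ Set.Icc (0 : ℝ) 1) :
    ∑ d, alg.dataProb Φ₁ r d * g d ≤ ∑ d, alg.dataProb Φ₀ r d * g d + 1 / 8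
      + 2 * ∑ t, ∑ k : Fin N, ∑ d, alg.dataProb Φ₀ r d * D (d t k.castSucc) := by
  have h := sum_le_sum_add_kl (E := alg.exploreLik r) (L₀ := Φ₀.dataLik) (L₁ := Φ₁.dataLik)
    (alg.exploreLik_nonneg r) h₀.dataLik_pos h₁.dataLik_pos
    (by simp_rw [← alg.dataProb_eq]; exact alg.sum_dataProb r h₀.toStochastic)
    (by simp_rw [← alg.dataProb_eq]; exact alg.sum_dataProb r h₁.toStochastic)
    (fun d => (hg d).1) (fun d => (hg d).2)
  have hk := alg.kl_le r h₀ h₁ hD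
  simp_rw [← alg.dataProb_eq] at h hk
  linarith

theorem Algorithm.exp_neg_le_sum_dataProb (h₀ : Φ₀.Positive) (h₁ : Φ₁.Positive)
    {D : Fin n × Fin A → ℝ}
    (hD : ∀ z, ∑ y, (Φ₀.ker z.1 z.2 y - Φ₁.ker z.1 z.2 y) ^ 2 / Φ₁.ker z.1 z.2 y ≤ D z)
    {K : ℝ} (hK : ∑ t, ∑ k : Fin N, ∑ d, alg.dataProb Φ₀ r d * D (d t k.castSucc) ≤ K)
    {g₀ g₁ : Data n A (N + 1) T → ℝ} (hg₀ : ∀ d, 0 ≤ g₀ d) (hg₁ : ∀ d, 0 ≤ g₁ d)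
    (hg : ∀ d, 1 ≤ g₀ d + g₁ d) :
    Real.exp (-K) / 2
      ≤ ∑ d, alg.dataProb Φ₀ r d * g₀ d + ∑ d, alg.dataProb Φ₁ r d * g₁ d := by
  have h := bretagnolle_huber (E := alg.exploreLik r) (L₀ := Φ₀.dataLik) (L₁ := Φ₁.dataLik)
    (alg.exploreLik_nonneg r) h₀.dataLik_pos h₁.dataLik_pos
    (by simp_rw [← alg.dataProb_eq]; exact alg.sum_dataProb r h₀.toStochastic)
    (by simp_rw [← alg.dataProb_eq]; exact alg.sum_dataProb r h₁.toStochastic) hg₀ hg₁ hg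
  have hk := (alg.kl_le r h₀ h₁ hD).trans hK
  simp_rw [← alg.dataProb_eq] at h hk
  refine le_trans ?_ h
  gcongr

end Comparison

theorem labelCov_self (f : Fin n → Fin S) :
    labelCov f topLabel (fun x => topLabel (f x))
      = (1 - meanLabel f topLabel) * meanLabel f topLabel := by
  have : ∀ x, (topLabel (f x) - meanLabel f topLabel) * topLabel (f x)
      = (1 - meanLabel f topLabel) * topLabel (f x) := by
    intro x
    rw [sub_mul, topLabel_mul_self]
    ring
  unfold labelCov
  simp_rw [this]
  rw [← Finset.mul_sum, mul_left_comm]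
  rfl

section ActionIdentification

variable [NeZero S]

/-- The model in which the best actions, if any, are given by `o`. -/
def actionModel (n : ℕ) (Δ : ℝ) (o : Fin S → Option (Fin A)) : BMDP S n A :=
  tiltedModel (blockLabel n fun _ => 1) topLabel (actionTilt Δ o)

/-- Deleting the best action of `s` changes one tilt, by at most `2Δ`; each of the `n` terms is then
at most `2 (2Δ)² / n`. -/
theorem chiSq_actionModel_le (hn : 4 * S ≤ n) {Δ : ℝ} (hΔ : 0 ≤ Δ) (hΔ' : Δ ≤ 1 / 2)
    (o : Fin S → Fin A) (s : Fin S) (z : Fin n × Fin A) :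
    ∑ y, ((actionModel n Δ (Function.update (fun s => some (o s)) s none)).ker z.1 z.2 y
        - (actionModel n Δ fun s => some (o s)).ker z.1 z.2 y) ^ 2
        / (actionModel n Δ fun s => some (o s)).ker z.1 z.2 y
      ≤ if blockLabel n (fun _ => 1) z.1 = s ∧ z.2 = o s then 8 * Δ ^ 2 else 0 := by
  have h₀ := tiltBounds_actionTilt hn (fun _ => 1) hΔ hΔ'
    (Function.update (fun s => some (o s)) s none)
  have h₁ := tiltBounds_actionTilt hn (fun _ => 1) hΔ hΔ' (fun s => some (o s))
  have hn0 := h₀.n_cast_pos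
  simp only [actionModel]
  split_ifs with hz
  · calc _ ≤ ∑ _y : Fin n, 2 * (2 * Δ) ^ 2 / n := by
          refine Finset.sum_le_sum fun y _ => sq_sub_div_le hn0 (h₁.ker_bounds _ _ _).1 ?_
          rw [h₀.ker_eq, h₁.ker_eq, ← mul_sub, add_sub_add_left_eq_sub, ← sub_mul, abs_mul,
            abs_mul, abs_of_nonneg (by positivity), one_div_mul_eq_div]
          refine div_le_div_of_nonneg_right ?_ hn0.le
          calc _ ≤ (Δ + Δ) * 1 :=
                mul_le_mul ((abs_sub _ _).trans
                  (add_le_add (h₀.abs_tilt_le _ _) (h₁.abs_tilt_le _ _)))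
                  (h₀.abs_label_sub_le _) (abs_nonneg _) (by positivity)
            _ = 2 * Δ := by ring
      _ = 8 * Δ ^ 2 := by
          simp only [Finset.sum_const, Finset.card_univ, Fintype.card_fin, nsmul_eq_mul]
          field_simp
          ring
  · refine le_of_eq (Finset.sum_eq_zero fun y _ => ?_)
    have : actionTilt Δ (Function.update (fun s => some (o s)) s none)
        (blockLabel n (fun _ => 1) z.1) z.2
        = actionTilt Δ (fun s => some (o s)) (blockLabel n (fun _ => 1) z.1) z.2 := by
      unfold actionTilt
      by_cases hs : blockLabel n (fun _ => 1) z.1 = s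
      · have : o s ≠ z.2 := fun h => hz ⟨hs, h.symm⟩
        simp [hs, this]
      · rw [Function.update_of_ne hs]
    rw [h₀.ker_eq, h₁.ker_eq, this, sub_self]
    simp

/-- Averaged over the best action of the state of `x`, an algorithm plays the best action in `x`
only with probability `1 / A + 1 / 8`, up to the information gained by exploration. -/
theorem sum_update_meanOutput_le (hn : 4 * S ≤ n) (hN : 1 ≤ N) {Δ : ℝ} (hΔ : 0 ≤ Δ)
    (hΔ' : Δ ≤ 1 / 2) (alg : Algorithm n A (N + 1) T) (r : Reward n A (N + 1))
    (o : Fin S → Fin A) (x : Fin n) (s : Fin S) :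
    ∑ a, ∑ d, alg.dataProb (actionModel n Δ fun s' => some (Function.update o s a s')) r d
        * alg.meanOutput r d x a
      ≤ 1 + A / 8 + 64 * Δ ^ 2 * (T * N) / S := by
  have : Nonempty (Fin n × Fin A) := ⟨(x, o s)⟩
  have hS : (0 : ℝ) < S := by exact_mod_cast NeZero.pos S
  set f := blockLabel n (fun _ => (1 : Equiv.Perm (Fin S)))
  -- State `s` has no best action in `Φ₀`, so one reference model serves all `A` alternatives.
  set Φ₀ := actionModel n Δ (Function.update (fun s' => some (o s')) s none) with hΦ₀
  have h₀ : Φ₀.Positive := (tiltBounds_actionTilt hn (fun _ => 1) hΔ hΔ' _).positive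
  have hn0 := (tiltBounds_actionTilt hn (fun _ => 1) hΔ hΔ' fun s' => some (o s')).n_cast_pos
  have hnull : ∀ a, Function.update (fun s' => some (Function.update o s a s')) s none
      = Function.update (fun s' => some (o s')) s none := by
    intro a
    funext s'
    by_cases hs : s' = s
    · subst hs; simp
    · simp [Function.update_of_ne hs]
  have hstep : ∀ a, ∑ d, alg.dataProb
      (actionModel n Δ fun s' => some (Function.update o s a s')) r d * alg.meanOutput r d x a
      ≤ ∑ d, alg.dataProb Φ₀ r d * alg.meanOutput r d x a + 1 / 8
        + 2 * ∑ t, ∑ k : Fin N, ∑ d, alg.dataProb Φ₀ r d *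
          (if f (d t k.castSucc).1 = s ∧ (d t k.castSucc).2 = a then 8 * Δ ^ 2 else 0) := by
    intro a
    refine alg.sum_dataProb_mul_le_add r h₀
      (tiltBounds_actionTilt hn (fun _ => 1) hΔ hΔ' _).positive
      (D := fun z => if f z.1 = s ∧ z.2 = a then 8 * Δ ^ 2 else 0) (fun z => ?_)
      (fun d => alg.meanOutput_mem r d x a)
    have := chiSq_actionModel_le hn hΔ hΔ' (Function.update o s a) s z
    rw [hnull, Function.update_self] at this
    exact this
  -- Summed over `a`, the visits to `(s, a)` are the visits to `s`, of probability at most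
  -- `(2/n)(2n/S) = 4/S`. This sharing is the source of the factor `A`.
  have hvisit : ∀ t, ∀ k : Fin N, ∑ a, ∑ d, alg.dataProb Φ₀ r d *
      (if f (d t k.castSucc).1 = s ∧ (d t k.castSucc).2 = a then 8 * Δ ^ 2 else 0)
      ≤ 32 * Δ ^ 2 / S := by
    intro t k
    rw [Finset.sum_comm]
    have e : ∀ d : Data n A (N + 1) T, ∑ a, alg.dataProb Φ₀ r d *
        (if f (d t k.castSucc).1 = s ∧ (d t k.castSucc).2 = a then 8 * Δ ^ 2 else 0)
        = alg.dataProb Φ₀ r d *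
          (fun y => if f y = s then 8 * Δ ^ 2 else 0) (d t k.castSucc).1 := by
      intro d
      rw [← Finset.mul_sum]
      by_cases hs : f (d t k.castSucc).1 = s <;> simp [hs]
    simp_rw [e]
    have hctx := alg.sum_dataProb_mul_context_le r h₀ (C := 2) (by norm_num)
      (fun x a y => ((tiltBounds_actionTilt hn (fun _ => 1) hΔ hΔ' _).ker_bounds x a y).2)
      t k.castSucc (g := fun y => if f y = s then 8 * Δ ^ 2 else 0)
      (fun y => by split_ifs <;> positivity)
    refine hctx.trans ?_
    rw [← Finset.sum_filter, Finset.sum_const, nsmul_eq_mul]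
    change 2 / (n : ℝ) * (clusterSize f s * (8 * Δ ^ 2)) ≤ _
    have hsize : clusterSize f s ≤ 2 * n / S := by
      have h1 := clusterSize_blockLabel_le (n := n) (fun _ => (1 : Equiv.Perm (Fin S))) s
      have h2 : ((n / S : ℕ) : ℝ) ≤ n / S := Nat.cast_div_le
      have h3 : (1 : ℝ) ≤ n / S := by
        rw [one_le_div hS]
        exact_mod_cast (by omega : S ≤ n)
      calc _ ≤ ((n / S : ℕ) : ℝ) + 1 := h1
        _ ≤ n / S + n / S := by linarith
        _ = _ := by ring
    calc _ ≤ 2 / (n : ℝ) * (2 * n / S * (8 * Δ ^ 2)) := by gcongr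
      _ = 32 * Δ ^ 2 / S := by field_simp; ring
  calc _ ≤ ∑ a, (∑ d, alg.dataProb Φ₀ r d * alg.meanOutput r d x a + 1 / 8
        + 2 * ∑ t, ∑ k : Fin N, ∑ d, alg.dataProb Φ₀ r d *
          (if f (d t k.castSucc).1 = s ∧ (d t k.castSucc).2 = a then 8 * Δ ^ 2 else 0)) :=
        Finset.sum_le_sum fun a _ => hstep a
    _ = 1 + A / 8 + 2 * ∑ t, ∑ k : Fin N, ∑ a, ∑ d, alg.dataProb Φ₀ r d *
          (if f (d t k.castSucc).1 = s ∧ (d t k.castSucc).2 = a then 8 * Δ ^ 2 else 0) := by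
        rw [Finset.sum_add_distrib, Finset.sum_add_distrib]
        congr 1
        · congr 1
          · rw [Finset.sum_comm]
            simp_rw [← Finset.mul_sum, alg.sum_meanOutput hN, mul_one]
            exact alg.sum_dataProb r h₀.toStochastic
          · simp; ring
        · rw [← Finset.mul_sum, Finset.sum_comm]
          congr 1
          exact Finset.sum_congr rfl fun t _ => Finset.sum_comm
    _ ≤ 1 + A / 8 + 2 * ∑ _t : Fin T, ∑ _k : Fin N, 32 * Δ ^ 2 / S := by
        gcongr with t _ k _
        exact hvisit t k
    _ = _ := by
        simp only [Finset.sum_const, Finset.card_univ, Fintype.card_fin, nsmul_eq_mul]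
        ring

/-- The exploration needed to identify the best action of every latent state. -/
theorem action_sample_bound (hS : 2 ≤ S) (hA : 2 ≤ A) (hn : 4 * S ≤ n) (hN : 1 ≤ N)
    {η ε Δ₀ : ℝ} (hε : 0 < ε) (hεΔ : 512 * ε ≤ Δ₀) (hΔ₀ : Δ₀ ≤ 1 / 2)
    (hη : (1 + Δ₀) ^ 2 ≤ η * (1 - Δ₀)) (hn' : 1 ≤ Δ₀ * (n / S : ℕ))
    {alg : Algorithm n A (N + 1) T} (hg : alg.Guarantee S η ε) :
    (S : ℝ) * A / ε ^ 2 ≤ 2 ^ 26 * (T * N) := by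
  -- With covariance at least `1/16`, being wrong on an eighth of the contexts costs at least
  -- `(1/16) Δ/(4n) · n/8 = Δ/512`.
  set Δ := 512 * ε with hΔdef
  have hΔ : 0 < Δ := by positivity
  have hΔ' : Δ ≤ 1 / 2 := hεΔ.trans hΔ₀
  set f := blockLabel n (fun _ => (1 : Equiv.Perm (Fin S))) with hf
  set r := ctxReward A N fun x => topLabel (f x) with hr
  have hS0 : (0 : ℝ) < S := by exact_mod_cast NeZero.pos S
  have hA0 : (2 : ℝ) ≤ A := by exact_mod_cast hA
  have hn0 : (0 : ℝ) < n := by exact_mod_cast (by omega : 0 < n)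
  have hne : Nonempty (Fin n × Fin A) := ⟨(⟨0, by omega⟩, ⟨0, by omega⟩)⟩
  have hneA : Nonempty (Fin A) := ⟨⟨0, by omega⟩⟩
  have hcov : 1 / 16 ≤ labelCov f topLabel fun x => topLabel (f x) := by
    have := meanLabel_topLabel_mem hS hn (fun _ => (1 : Equiv.Perm (Fin S)))
    rw [labelCov_self]
    nlinarith [this.1, this.2]
  let F : (Fin S → Fin A) → Fin n → ℝ := fun o x =>
    ∑ d, alg.dataProb (actionModel n Δ fun s => some (o s)) r d * alg.meanOutput r d x (o (f x))
  have hlow : ∀ o : Fin S → Fin A, 7 / 8 * (n : ℝ) ≤ ∑ x, F o x := by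
    intro o
    have h := tiltBounds_actionTilt hn (fun _ => 1) hΔ.le hΔ' fun s => some (o s)
    have hl := (h.expectedLoss_ge hN hΔ.le (by linarith) (actionTilt_self Δ o)
      (actionTilt_nonpos hΔ.le o) alg).trans (hg.expectedLoss_le hS hA hn hN (fun _ => 1) hΔ hεΔ
        hΔ₀ hη hn' o (w := fun x => topLabel (f x)) fun x => topLabel_mem _)
    have e : ∑ x, ∑ d, alg.dataProb (tiltedModel f topLabel
        (actionTilt Δ fun s => some (o s))) r d * (1 - alg.meanOutput r d x (o (f x)))
        = n - ∑ x, F o x := by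
      have : ∀ x, ∑ d, alg.dataProb (tiltedModel f topLabel
          (actionTilt Δ fun s => some (o s))) r d * (1 - alg.meanOutput r d x (o (f x)))
          = 1 - F o x := by
        intro x
        simp_rw [mul_sub, mul_one]
        rw [Finset.sum_sub_distrib, alg.sum_dataProb r h.positive.toStochastic]
        rfl
      simp_rw [this]
      simp
    rw [e] at hl
    by_contra! hlt
    have h1 : (n : ℝ) / 8 < n - ∑ x, F o x := by linarith
    have h2 : 1 / 16 * Δ / (4 * n) * (n / 8) = ε := by rw [hΔdef]; field_simp; norm_num
    have h3 : 1 / 16 * Δ / (4 * n) * (n / 8)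
        < labelCov f topLabel (fun x => topLabel (f x)) * Δ / (4 * n) * (n - ∑ x, F o x) := by
      calc 1 / 16 * Δ / (4 * n) * (n / 8) < 1 / 16 * Δ / (4 * n) * (n - ∑ x, F o x) :=
            mul_lt_mul_of_pos_left h1 (by positivity)
        _ ≤ _ := by
            refine mul_le_mul_of_nonneg_right ?_ (by linarith)
            gcongr
    linarith
  -- Averaging over all assignments `o` includes resampling the best action of the state of `x`.
  have hup : ∀ x, A * ∑ o, F o x
      ≤ Fintype.card (Fin S → Fin A) * (1 + A / 8 + 64 * Δ ^ 2 * (T * N) / S) := by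
    intro x
    have := sum_sum_update (Ω := Fin A) (f x) fun o => F o x
    rw [Fintype.card_fin] at this
    rw [← this, ← nsmul_eq_mul, ← Finset.card_univ, ← Finset.sum_const]
    refine Finset.sum_le_sum fun o _ => ?_
    have h := sum_update_meanOutput_le hn hN hΔ.le hΔ' alg r o x (f x)
    simp only [F, Function.update_self]
    exact h
  set M : ℝ := ((Fintype.card (Fin S → Fin A) : ℕ) : ℝ) with hM
  have hM0 : 0 < M := by
    rw [hM]
    exact_mod_cast Fintype.card_pos
  have h1 : A * (M * (7 / 8 * n)) ≤ ∑ x, A * ∑ o, F o x := by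
    rw [← Finset.mul_sum, Finset.sum_comm]
    gcongr
    calc M * (7 / 8 * n) = ∑ _o : Fin S → Fin A, 7 / 8 * (n : ℝ) := by
          rw [Finset.sum_const, Finset.card_univ, nsmul_eq_mul]
      _ ≤ _ := Finset.sum_le_sum fun o _ => hlow o
  have h2 := h1.trans (Finset.sum_le_sum fun x _ => hup x)
  simp only [Finset.sum_const, Finset.card_univ, Fintype.card_fin, nsmul_eq_mul] at h2
  have h3 : A * (7 / 8) ≤ 1 + A / 8 + 64 * Δ ^ 2 * (T * N) / S := by
    refine le_of_mul_le_mul_left ?_ (mul_pos hn0 hM0)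
    calc (n : ℝ) * M * (A * (7 / 8)) = A * (M * (7 / 8 * n)) := by ring
      _ ≤ _ := h2
      _ = _ := by ring
  -- `3A/4 - 1 ≥ A/4` because `A ≥ 2`.
  have h4 : (A : ℝ) / 4 ≤ 64 * Δ ^ 2 * (T * N) / S := by linarith
  rw [le_div_iff₀ hS0] at h4
  rw [div_le_iff₀ (by positivity)]
  have h5 : 64 * Δ ^ 2 * (T * N) = 2 ^ 24 * ε ^ 2 * (T * N) := by rw [hΔdef]; ring
  rw [h5] at h4
  linarith

end ActionIdentification

end BlockMDP

end

/-! ### Lower bound for identifying the latent states of contexts. -/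

noncomputable section

namespace BlockMDP

variable {S n A N T K : ℕ}

section ContextIdentification

variable [NeZero S]

/-- Swap the first two latent states in the blocks selected by `v`. -/
def blockSwap (hS : 2 ≤ S) (v : Fin K → Bool) (k : ℕ) : Equiv.Perm (Fin S) :=
  if h : k < K then
    if v ⟨k, h⟩ then Equiv.swap ⟨0, by omega⟩ ⟨1, by omega⟩ else 1
  else 1

/-- Change one coordinate of a Boolean vector. -/
def flipAt (k : Fin K) (v : Fin K → Bool) : Fin K → Bool := Function.update v k (!v k)

theorem flipAt_involutive (k : Fin K) : Function.Involutive (flipAt k) := by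
  intro v
  funext i
  by_cases h : i = k
  · subst h; simp [flipAt]
  · simp [flipAt, Function.update_of_ne h]

omit [NeZero S] in
theorem block_lt (hK : K ≤ n / S) (k : Fin K) (i : ℕ) (hi : i < S) :
    S * k + i < n := by
  have h1 : S * ((k : ℕ) + 1) ≤ n :=
    (Nat.mul_le_mul_left S (by omega : (k : ℕ) + 1 ≤ n / S)).trans (Nat.mul_div_le n S)
  rw [mul_add, mul_one] at h1
  omega

/-- The `i`-th context of block `k`. -/
def blockContext (hK : K ≤ n / S) (i : ℕ) (hi : i < S) (k : Fin K) : Fin n :=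
  ⟨S * k + i, block_lt hK k i hi⟩

theorem blockLabel_blockContext (hS : 2 ≤ S) (hK : K ≤ n / S) (v : Fin K → Bool) (i : ℕ)
    (hi : i < S) (k : Fin K) :
    blockLabel n (blockSwap hS v) (blockContext hK i hi k)
      = (if v k then Equiv.swap ⟨0, by omega⟩ ⟨1, by omega⟩ else 1 : Equiv.Perm (Fin S))
          ⟨i, hi⟩ := by
  have hdiv : (S * (k : ℕ) + i) / S = k := by
    rw [Nat.mul_add_div (NeZero.pos S), Nat.div_eq_of_lt hi, add_zero]
  simp only [blockLabel, blockContext, hdiv, Nat.mul_add_mod, Nat.mod_eq_of_lt hi, blockSwap,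
    k.is_lt, dif_pos, Fin.eta]

/-- The pair of contexts whose labels are exchanged by `flipAt k`. -/
def blockPair (hS : 2 ≤ S) (hK : K ≤ n / S) (k : Fin K) : Finset (Fin n) :=
  {blockContext hK 0 (by omega) k, blockContext hK 1 (by omega) k}

theorem blockLabel_flip (hS : 2 ≤ S) (hK : K ≤ n / S) (v : Fin K → Bool) (k : Fin K)
    (x : Fin n) (hx : x ∉ blockPair hS hK k) :
    blockLabel n (blockSwap hS (flipAt k v)) x = blockLabel n (blockSwap hS v) x := by
  simp only [blockPair, Finset.mem_insert, Finset.mem_singleton, not_or, Fin.ext_iff,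
    blockContext] at hx
  by_cases hk : (x : ℕ) / S = k
  · have hdm := Nat.div_add_mod (x : ℕ) S
    rw [hk] at hdm
    have h0 : (x : ℕ) % S ≠ 0 := fun h => hx.1 (by rw [h] at hdm; exact hdm.symm)
    have h1 : (x : ℕ) % S ≠ 1 := fun h => hx.2 (by rw [h] at hdm; exact hdm.symm)
    have hfix : ∀ u : Fin K → Bool, blockLabel n (blockSwap hS u) x
        = ⟨x % S, Nat.mod_lt _ (NeZero.pos S)⟩ := by
      intro u
      simp only [blockLabel, blockSwap, hk, k.is_lt, dif_pos]
      split_ifs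
      · exact Equiv.swap_apply_of_ne_of_ne (by simpa [Fin.ext_iff] using h0)
          (by simpa [Fin.ext_iff] using h1)
      · rfl
    rw [hfix, hfix]
  · have : blockSwap hS (flipAt k v) ((x : ℕ) / S) = blockSwap hS v ((x : ℕ) / S) := by
      unfold blockSwap
      split_ifs with h h1 h2 h2 <;> try rfl
      all_goals
        rw [flipAt, Function.update_of_ne (by rw [Ne, Fin.ext_iff]; exact hk)] at h1
        contradiction
    simp only [blockLabel, this]

omit [NeZero S] in
theorem blockContext_ne (hS : 2 ≤ S) (hK : K ≤ n / S) (k : Fin K) :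
    blockContext hK 0 (by omega) k ≠ blockContext hK 1 (by omega) k := by
  simp [blockContext]

/-- The exchange preserves all cluster sizes, so the centring, and with it the kernel away from the
pair, is unchanged. -/
theorem meanLabel_flip (hS : 2 ≤ S) (hK : K ≤ n / S) (v : Fin K → Bool) (k : Fin K)
    (b : Fin S → ℝ) :
    meanLabel (blockLabel n (blockSwap hS (flipAt k v))) b
      = meanLabel (blockLabel n (blockSwap hS v)) b := by
  have hsplit : ∀ u : Fin K → Bool, ∑ x, b (blockLabel n (blockSwap hS u) x)
      = ∑ x ∈ blockPair hS hK k, b (blockLabel n (blockSwap hS u) x)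
        + ∑ x ∈ (blockPair hS hK k)ᶜ, b (blockLabel n (blockSwap hS u) x) := fun u =>
    (Finset.sum_add_sum_compl _ _).symm
  unfold meanLabel
  rw [hsplit, hsplit]
  congr 2
  · unfold blockPair
    rw [Finset.sum_pair (blockContext_ne hS hK k), Finset.sum_pair (blockContext_ne hS hK k)]
    simp only [blockLabel_blockContext, flipAt, Function.update_self]
    cases v k
    · simp [add_comm]
    · simp [add_comm]
  · exact Finset.sum_congr rfl fun x hx => by
      rw [blockLabel_flip hS hK v k x (by simpa using hx)]

/-- Action `a₀` is best in the first latent state and action `a₁` in all others. -/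
def firstBest (a₀ a₁ : Fin A) (s : Fin S) : Fin A := if (s : ℕ) = 0 then a₀ else a₁

/-- The model with the labels determined by `v`. -/
def contextModel (n : ℕ) (hS : 2 ≤ S) (Δ : ℝ) (a₀ a₁ : Fin A) (v : Fin K → Bool) : BMDP S n A :=
  tiltedModel (blockLabel n (blockSwap hS v)) topLabel
    (actionTilt Δ fun s => some (firstBest a₀ a₁ s))

/-- From outside the pair only the two probabilities of entering it change, at most `2/n` each. From
inside it all `n` terms may change. -/
theorem chiSq_contextModel_le (hS : 2 ≤ S) (hn : 4 * S ≤ n) (hK : K ≤ n / S) {Δ : ℝ}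
    (hΔ : 0 ≤ Δ) (hΔ' : Δ ≤ 1 / 2) (a₀ a₁ : Fin A) (v : Fin K → Bool) (k : Fin K)
    (z : Fin n × Fin A) :
    ∑ y, ((contextModel n hS Δ a₀ a₁ v).ker z.1 z.2 y
        - (contextModel n hS Δ a₀ a₁ (flipAt k v)).ker z.1 z.2 y) ^ 2
        / (contextModel n hS Δ a₀ a₁ (flipAt k v)).ker z.1 z.2 y
      ≤ 4 / n + if z.1 ∈ blockPair hS hK k then 2 else 0 := by
  have h := fun u : Fin K → Bool => tiltBounds_actionTilt hn (blockSwap hS u) hΔ hΔ'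
    (fun s => some (firstBest a₀ a₁ s))
  have hn0 := (h v).n_cast_pos
  have hbound : ∀ y, ((contextModel n hS Δ a₀ a₁ v).ker z.1 z.2 y
        - (contextModel n hS Δ a₀ a₁ (flipAt k v)).ker z.1 z.2 y) ^ 2
        / (contextModel n hS Δ a₀ a₁ (flipAt k v)).ker z.1 z.2 y
      ≤ (if y ∈ blockPair hS hK k then 2 / (n : ℝ) else 0)
        + if z.1 ∈ blockPair hS hK k then 2 / (n : ℝ) else 0 := by
    intro y
    have hmax : ((contextModel n hS Δ a₀ a₁ v).ker z.1 z.2 y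
        - (contextModel n hS Δ a₀ a₁ (flipAt k v)).ker z.1 z.2 y) ^ 2
        / (contextModel n hS Δ a₀ a₁ (flipAt k v)).ker z.1 z.2 y ≤ 2 / n := by
      have := sq_sub_div_le (e := 1) (k₀ := (contextModel n hS Δ a₀ a₁ v).ker z.1 z.2 y) hn0
        ((h (flipAt k v)).ker_bounds z.1 z.2 y).1 (by
          unfold contextModel
          rw [(h v).ker_eq, (h (flipAt k v)).ker_eq, ← mul_sub, add_sub_add_left_eq_sub, abs_mul,
            abs_of_nonneg (by positivity), one_div_mul_eq_div]
          refine div_le_div_of_nonneg_right ?_ hn0.le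
          refine (abs_sub _ _).trans ?_
          have e1 := (h v).abs_mul_le ((h v).abs_tilt_le (blockLabel n (blockSwap hS v) z.1) z.2)
            (blockLabel n (blockSwap hS v) y)
          have e2 := (h (flipAt k v)).abs_mul_le ((h (flipAt k v)).abs_tilt_le
            (blockLabel n (blockSwap hS (flipAt k v)) z.1) z.2)
            (blockLabel n (blockSwap hS (flipAt k v)) y)
          linarith)
      simpa [contextModel] using this
    by_cases hy : y ∈ blockPair hS hK k
    · rw [if_pos hy]
      exact hmax.trans (le_add_of_nonneg_right (by split_ifs <;> positivity))
    · by_cases hz : z.1 ∈ blockPair hS hK k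
      · rw [if_pos hz]
        exact hmax.trans (le_add_of_nonneg_left (by split_ifs; positivity))
      · rw [if_neg hy, if_neg hz]
        unfold contextModel
        rw [(h v).ker_eq, (h (flipAt k v)).ker_eq, blockLabel_flip hS hK v k y hy,
          blockLabel_flip hS hK v k z.1 hz, meanLabel_flip hS hK, sub_self]
        simp
  refine (Finset.sum_le_sum fun y _ => hbound y).trans (le_of_eq ?_)
  rw [Finset.sum_add_distrib, ← Finset.sum_filter, Finset.filter_mem_eq_inter,
    Finset.univ_inter, Finset.sum_const, blockPair, Finset.card_pair (blockContext_ne hS hK k)]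
  congr 1
  · simp; ring
  · simp only [Finset.sum_const, Finset.card_univ, Fintype.card_fin, nsmul_eq_mul]
    split_ifs
    · field_simp
    · simp

/-- Two models that differ in the labels of one pair of contexts cannot be told apart well. -/
theorem exp_neg_le_sum_flip (hS : 2 ≤ S) (hn : 4 * S ≤ n) (hN : 1 ≤ N) (hK : K ≤ n / S) {Δ : ℝ}
    (hΔ : 0 ≤ Δ) (hΔ' : Δ ≤ 1 / 2) {a₀ a₁ : Fin A} (ha : a₀ ≠ a₁)
    (alg : Algorithm n A (N + 1) T) (r : Reward n A (N + 1)) (v : Fin K → Bool) (k : Fin K)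
    (x : Fin n) (hx : x = blockContext hK 0 (by omega) k) :
    Real.exp (-(12 * (T * N) / n)) / 2
      ≤ ∑ d, alg.dataProb (contextModel n hS Δ a₀ a₁ v) r d
          * (1 - alg.meanOutput r d x (firstBest a₀ a₁ (blockLabel n (blockSwap hS v) x)))
        + ∑ d, alg.dataProb (contextModel n hS Δ a₀ a₁ (flipAt k v)) r d
          * (1 - alg.meanOutput r d x
              (firstBest a₀ a₁ (blockLabel n (blockSwap hS (flipAt k v)) x))) := by
  have : Nonempty (Fin n × Fin A) := ⟨(x, a₀)⟩
  have h := fun u : Fin K → Bool => tiltBounds_actionTilt hn (blockSwap hS u) hΔ hΔ'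
    (fun s => some (firstBest a₀ a₁ s))
  have hn0 := (h v).n_cast_pos
  have hpos := fun u => (h u).positive
  refine alg.exp_neg_le_sum_dataProb r (hpos v) (hpos (flipAt k v))
    (chiSq_contextModel_le hS hn hK hΔ hΔ' a₀ a₁ v k) ?_
    (fun d => sub_nonneg.mpr (alg.meanOutput_mem r d x _).2)
    (fun d => sub_nonneg.mpr (alg.meanOutput_mem r d x _).2) ?_
  -- Per round: `4/n`, plus `2` times the probability, at most `2 · (2/n)`, of visiting the pair.
  · calc _ ≤ ∑ _t : Fin T, ∑ _k : Fin N, 12 / (n : ℝ) := by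
          refine Finset.sum_le_sum fun t _ => Finset.sum_le_sum fun i _ => ?_
          have hctx := alg.sum_dataProb_mul_context_le r (hpos v) (C := 2) (by norm_num)
            (fun x a y => ((h v).ker_bounds x a y).2) t i.castSucc
            (g := fun y => if y ∈ blockPair hS hK k then 2 else 0)
            (fun y => by split_ifs <;> norm_num)
          rw [← Finset.sum_filter, Finset.filter_mem_eq_inter, Finset.univ_inter,
            Finset.sum_const, blockPair, Finset.card_pair (blockContext_ne hS hK k)] at hctx
          simp_rw [mul_add]
          rw [Finset.sum_add_distrib, ← Finset.sum_mul]
          have hone := alg.sum_dataProb r (hpos v).toStochastic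
          rw [hone]
          refine (add_le_add_right hctx _).trans (le_of_eq ?_)
          simp
          ring
      _ = _ := by
          simp only [Finset.sum_const, Finset.card_univ, Fintype.card_fin, nsmul_eq_mul]
          ring
  · intro d
    have hs := alg.sum_meanOutput hN r d x
    have h2 : alg.meanOutput r d x a₀ + alg.meanOutput r d x a₁ ≤ 1 := by
      rw [← hs, ← Finset.sum_pair ha]
      exact Finset.sum_le_sum_of_subset_of_nonneg (Finset.subset_univ _)
        fun a _ _ => (alg.meanOutput_mem r d x a).1
    -- The flip moves `x` between the first two states, whose best actions are `a₀` and `a₁`; the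
    -- output cannot put mass close to one on both.
    rw [hx, blockLabel_blockContext, blockLabel_blockContext, ← hx]
    simp only [flipAt, Function.update_self]
    cases v k <;> simp [firstBest] <;> linarith

/-- The reward that pays the label in the contexts outside the first `K` blocks. -/
def knownReward (S n K : ℕ) [NeZero S] (x : Fin n) : ℝ :=
  if S * K ≤ (x : ℕ) then topLabel (⟨x % S, Nat.mod_lt _ (NeZero.pos S)⟩ : Fin S) else 0

theorem knownReward_mem (x : Fin n) : knownReward S n K x ∈ Set.Icc (0 : ℝ) 1 := by
  unfold knownReward
  split_ifs
  · exact topLabel_mem _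
  · simp

/-- Each of the `M` complete blocks after the first `K` has a first context with reward one. -/
theorem sum_knownReward_ge (hS : 2 ≤ S) {M : ℕ} (hKM : K + M ≤ n / S) :
    (M : ℝ) ≤ ∑ x : Fin n, knownReward S n K x := by
  let e : Fin M → Fin n := fun i =>
    blockContext hKM 0 (by omega) (Fin.natAdd K i)
  have he : Function.Injective e := by
    intro i j hij
    simp only [e, blockContext, Fin.mk.injEq, add_zero, Fin.val_natAdd] at hij
    have := Nat.eq_of_mul_eq_mul_left (by omega : 0 < S) hij
    exact Fin.ext (by omega)
  have hval : ∀ i, knownReward S n K (e i) = 1 := by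
    intro i
    simp only [knownReward, e, blockContext, Fin.val_natAdd, add_zero, Nat.mul_mod_right,
      topLabel]
    rw [if_pos (Nat.mul_le_mul_left S (by omega)), if_pos (by omega)]
  calc (M : ℝ) = ∑ i, knownReward S n K (e i) := by simp [hval]
    _ = ∑ x ∈ Finset.univ.map ⟨e, he⟩, knownReward S n K x := by rw [Finset.sum_map]; rfl
    _ ≤ _ := Finset.sum_le_sum_of_subset_of_nonneg (Finset.subset_univ _)
        fun x _ _ => (knownReward_mem x).1

/-- The algorithm knows the reward, which therefore must not reveal `v`. It equals the 0/1 label on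
the blocks that are never swapped and vanishes elsewhere. -/
theorem labelCov_knownReward (hS : 2 ≤ S) (v : Fin K → Bool) :
    labelCov (blockLabel n (blockSwap hS v)) topLabel (knownReward S n K)
      = (1 - meanLabel (blockLabel n (blockSwap hS v)) topLabel)
        * (1 / n * ∑ x, knownReward S n K x) := by
  have : ∀ x, (topLabel (blockLabel n (blockSwap hS v) x)
        - meanLabel (blockLabel n (blockSwap hS v)) topLabel) * knownReward S n K x
      = (1 - meanLabel (blockLabel n (blockSwap hS v)) topLabel) * knownReward S n K x := by
    intro x
    by_cases hx : S * K ≤ (x : ℕ)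
    · have hk : ¬ (x : ℕ) / S < K := by
        rw [not_lt, Nat.le_div_iff_mul_le (NeZero.pos S), mul_comm]
        exact hx
      have hl : blockLabel n (blockSwap hS v) x = ⟨x % S, Nat.mod_lt _ (NeZero.pos S)⟩ := by
        simp [blockLabel, blockSwap, hk]
      rw [knownReward, if_pos hx, hl, sub_mul, topLabel_mul_self]
      ring
    · simp [knownReward, hx]
  unfold labelCov
  simp_rw [this]
  rw [← Finset.mul_sum, mul_left_comm]

/-- The exploration needed to identify the latent state of most contexts. -/
theorem context_sample_bound (hS : 2 ≤ S) (hA : 2 ≤ A) (hn : 4 * S ≤ n) (hN : 1 ≤ N)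
    {η ε Δ : ℝ} (hΔ : 0 < Δ) (hΔ' : Δ ≤ 1 / 2)
    (hη : (1 + Δ) ^ 2 ≤ η * (1 - Δ)) (hn' : 1 ≤ Δ * (n / S : ℕ))
    {alg : Algorithm n A (N + 1) T} (hg : alg.Guarantee S η ε) :
    Δ / (1024 * S ^ 2) * Real.exp (-(12 * (T * N) / n)) ≤ ε := by
  have hS0 : (0 : ℝ) < S := by exact_mod_cast NeZero.pos S
  have hn0 : (0 : ℝ) < n := by exact_mod_cast (by omega : 0 < n)
  -- Half of the complete blocks hide the labels; at least `K` others remain to carry the reward.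
  set K := n / S / 2 with hKdef
  have hK : K ≤ n / S := Nat.div_le_self _ _
  have hKn : (n : ℝ) / (4 * S) ≤ K := by
    have hq : 4 ≤ n / S := (Nat.le_div_iff_mul_le (by omega)).mpr hn
    have h1 : n < S * (n / S + 1) := Nat.lt_mul_div_succ n (by omega)
    have h2 : n / S + 1 ≤ 4 * K := by omega
    have h3 : n ≤ K * (4 * S) := by nlinarith [Nat.mul_le_mul_left S h2]
    rw [div_le_iff₀ (by positivity)]
    exact_mod_cast h3
  set a₀ : Fin A := ⟨0, by omega⟩
  set a₁ : Fin A := ⟨1, by omega⟩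
  have ha : a₀ ≠ a₁ := by simp [a₀, a₁]
  set r := ctxReward A N (knownReward S n K) with hr
  set X : ℝ := Real.exp (-(12 * (T * N) / n)) with hX
  have hX0 : 0 < X := Real.exp_pos _
  let x : Fin K → Fin n := blockContext hK 0 (by omega)
  have hxinj : Function.Injective x := by
    intro i j hij
    simp only [x, blockContext, Fin.mk.injEq, add_zero] at hij
    exact Fin.ext (Nat.eq_of_mul_eq_mul_left (by omega : 0 < S) hij)
  let err : (Fin K → Bool) → Fin n → ℝ := fun v y =>
    ∑ d, alg.dataProb (contextModel n hS Δ a₀ a₁ v) r d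
      * (1 - alg.meanOutput r d y (firstBest a₀ a₁ (blockLabel n (blockSwap hS v) y)))
  have hT := fun u : Fin K → Bool => tiltBounds_actionTilt hn (blockSwap hS u) hΔ.le hΔ'
    (fun s => some (firstBest a₀ a₁ s))
  have herr : ∀ v y, 0 ≤ err v y := fun v y => Finset.sum_nonneg fun d _ =>
    mul_nonneg ((hT v).positive.dataProb_nonneg alg r d)
      (sub_nonneg.mpr (alg.meanOutput_mem r d y _).2)
  have hcov : ∀ v : Fin K → Bool, (K : ℝ) / (4 * n)
      ≤ labelCov (blockLabel n (blockSwap hS v)) topLabel (knownReward S n K) := by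
    intro v
    rw [labelCov_knownReward hS]
    have h1 := meanLabel_topLabel_mem hS hn (blockSwap hS v)
    have h2 := sum_knownReward_ge (n := n) hS (K := K) (M := K) (by omega)
    calc (K : ℝ) / (4 * n) = 1 / 4 * (1 / n * K) := by field_simp
      _ ≤ _ := mul_le_mul (by linarith [h1.2]) (by gcongr) (by positivity) (by linarith [h1.2])
  have hloss : ∀ v : Fin K → Bool, (K : ℝ) / (4 * n) * Δ / (4 * n) * ∑ k, err v (x k) ≤ ε := by
    intro v
    have hl := ((hT v).expectedLoss_ge hN hΔ.le (le_trans (by positivity) (hcov v))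
      (actionTilt_self Δ (firstBest a₀ a₁)) (actionTilt_nonpos hΔ.le _) alg).trans
      (hg.expectedLoss_le hS hA hn hN (blockSwap hS v) hΔ le_rfl hΔ' hη hn' (firstBest a₀ a₁)
        (w := knownReward S n K) fun y => knownReward_mem y)
    refine le_trans ?_ hl
    have hsub : ∑ k, err v (x k) ≤ ∑ y, err v y := by
      calc _ = ∑ y ∈ Finset.univ.map ⟨x, hxinj⟩, err v y := by rw [Finset.sum_map]; rfl
        _ ≤ _ := Finset.sum_le_sum_of_subset_of_nonneg (Finset.subset_univ _)
            fun y _ _ => herr v y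
    refine mul_le_mul ?_ hsub (Finset.sum_nonneg fun k _ => herr v _) ?_
    · gcongr
      exact hcov v
    · have := hcov v
      have : 0 ≤ labelCov (blockLabel n (blockSwap hS v)) topLabel (knownReward S n K) :=
        le_trans (by positivity) this
      positivity
  set M : ℝ := ((Fintype.card (Fin K → Bool) : ℕ) : ℝ) with hM
  have hM0 : 0 < M := by
    rw [hM]
    exact_mod_cast Fintype.card_pos
  -- The flip is a bijection of the vectors `v`, so both error sums have the same total and each
  -- receives half of `X/2`.
  have hflip : ∀ k, M * (X / 4) ≤ ∑ v, err v (x k) := by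
    intro k
    have h1 : ∑ v, err (flipAt k v) (x k) = ∑ v, err v (x k) :=
      Equiv.sum_comp (flipAt_involutive k).toPerm fun v => err v (x k)
    have h2 : M * (X / 2) ≤ ∑ v, (err v (x k) + err (flipAt k v) (x k)) := by
      calc M * (X / 2) = ∑ _v : Fin K → Bool, X / 2 := by
            rw [Finset.sum_const, Finset.card_univ, nsmul_eq_mul]
        _ ≤ _ := Finset.sum_le_sum fun v _ =>
            exp_neg_le_sum_flip hS hn hN hK hΔ.le hΔ' ha alg r v k (x k) rfl
    rw [Finset.sum_add_distrib, h1] at h2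
    linarith
  have hsum : (K : ℝ) / (4 * n) * Δ / (4 * n) * (K * (M * (X / 4))) ≤ M * ε := by
    calc _ ≤ (K : ℝ) / (4 * n) * Δ / (4 * n) * ∑ k, ∑ v, err v (x k) := by
          gcongr
          calc (K : ℝ) * (M * (X / 4)) = ∑ _k : Fin K, M * (X / 4) := by simp
            _ ≤ _ := Finset.sum_le_sum fun k _ => hflip k
      _ = ∑ v, (K : ℝ) / (4 * n) * Δ / (4 * n) * ∑ k, err v (x k) := by
          rw [Finset.sum_comm, Finset.mul_sum]
      _ ≤ ∑ _v : Fin K → Bool, ε := Finset.sum_le_sum fun v _ => hloss v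
      _ = M * ε := by rw [Finset.sum_const, Finset.card_univ, nsmul_eq_mul]
  refine le_of_mul_le_mul_left (le_trans ?_ hsum) hM0
  -- Both factors `K` are bounded below by `n/(4S)`: `1024 = 16 · 4 · 4 · 4`.
  calc M * (Δ / (1024 * S ^ 2) * X)
      = (n : ℝ) / (4 * S) / (4 * n) * Δ / (4 * n) * (n / (4 * S) * (M * (X / 4))) := by
        field_simp
        norm_num
    _ ≤ _ := by gcongr

end ContextIdentification

end BlockMDP

end

/-! ### Combination of the two bounds. -/

namespace BlockMDP

/-- For `0 < Δ ≤ 1/2`, `(1 + Δ)² ≤ 1 + 3Δ`, and `1 + 3Δ ≤ η (1 - Δ)` means `Δ ≤ (η - 1)/(3 + η)`. -/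
theorem exists_tilt_of_one_lt {η : ℝ} (hη : 1 < η) :
    ∃ Δ : ℝ, 0 < Δ ∧ Δ ≤ 1 / 2 ∧ (1 + Δ) ^ 2 ≤ η * (1 - Δ) := by
  have hpos : 0 < (η - 1) / (3 + η) := div_pos (by linarith) (by linarith)
  refine ⟨min (1 / 2) ((η - 1) / (3 + η)), lt_min (by norm_num) hpos, min_le_left _ _, ?_⟩
  have h0 : 0 < min (1 / 2) ((η - 1) / (3 + η)) := lt_min (by norm_num) hpos
  have h1 := min_le_left (1 / 2) ((η - 1) / (3 + η))
  have h2 := min_le_right (1 / 2) ((η - 1) / (3 + η))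
  rw [le_div_iff₀ (by linarith)] at h2
  nlinarith

/-- `κ ≥ √ε` gives `κ/ε ≥ ε^(-1/2)`. The constant `κ` will depend on `η` and `S`; absorbing it for
small `ε` is what keeps `c` universal. -/
theorem half_log_le_log_div {κ ε : ℝ} (hκ : 0 < κ) (hε : 0 < ε) (h : ε ≤ κ ^ 2) :
    Real.log (1 / ε) / 2 ≤ Real.log (κ / ε) := by
  have := Real.log_le_log hε h
  rw [Real.log_pow] at this
  rw [Real.log_div one_ne_zero hε.ne', Real.log_div hκ.ne' hε.ne', Real.log_one]
  push_cast at this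
  linarith

end BlockMDP

open BlockMDP in
theorem theorem3 :
    ∃ c : ℝ, 0 < c ∧
      ∀ (η : ℝ), 1 < η → ∀ (S A : ℕ), 2 ≤ S → 2 ≤ A →
        ∀ (ε : ℕ → ℝ), (∀ n, 0 < ε n) → Tendsto ε atTop (𝓝 0) →
          ∀ᶠ n : ℕ in atTop, ∀ (H T : ℕ), 2 ≤ H →
            ∀ alg : BlockMDP.Algorithm n A H T, alg.Guarantee S η (ε n) →
              c * ((n : ℝ) * Real.log (1 / ε n) + (S : ℝ) * (A : ℝ) / (ε n) ^ 2)
                ≤ (T : ℝ) * (H : ℝ) := by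
  -- The sum of the constants in the context bound `24` and in the action bound `2 ^ 26`.
  refine ⟨1 / (24 + 2 ^ 26), by norm_num, fun η hη S A hS hA ε hε hlim => ?_⟩
  obtain ⟨Δ, hΔ, hΔ', hηΔ⟩ := exists_tilt_of_one_lt hη
  have : NeZero S := ⟨by omega⟩
  have hS0 : (0 : ℝ) < S := by exact_mod_cast (by omega : 0 < S)
  have hκ : 0 < Δ / (1024 * (S : ℝ) ^ 2) := by positivity
  -- In order: enough complete blocks, cluster sizes balanced up to `1 + Δ`, the action tilt `512 ε`
  -- below `Δ`, and `ε ≤ κ²` for the logarithm.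
  filter_upwards [eventually_ge_atTop (4 * S), eventually_ge_atTop (S * ⌈1 / Δ⌉₊),
    hlim.eventually (ge_mem_nhds (by positivity : 0 < Δ / 512)),
    hlim.eventually (ge_mem_nhds (by positivity : 0 < (Δ / (1024 * (S : ℝ) ^ 2)) ^ 2))]
    with n hn hnΔ hε₁ hε₂ H T hH alg hg
  obtain ⟨N, rfl⟩ : ∃ N, H = N + 1 := ⟨H - 1, by omega⟩
  have hN : 1 ≤ N := by omega
  have hn0 : (0 : ℝ) < n := by exact_mod_cast (by omega : 0 < n)
  have hblocks : 1 ≤ Δ * ((n / S : ℕ) : ℝ) := by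
    have h1 : ⌈1 / Δ⌉₊ ≤ n / S := (Nat.le_div_iff_mul_le (by omega)).mpr (by rwa [mul_comm])
    have h2 : 1 / Δ ≤ ((n / S : ℕ) : ℝ) := (Nat.le_ceil _).trans (by exact_mod_cast h1)
    rwa [div_le_iff₀' hΔ] at h2
  have hact := action_sample_bound hS hA hn hN (hε n)
    (by rw [le_div_iff₀ (by norm_num)] at hε₁; linarith) hΔ' hηΔ hblocks hg
  have hctx := context_sample_bound hS hA hn hN hΔ hΔ' hηΔ hblocks hg
  have hlog : (n : ℝ) * Real.log (1 / ε n) ≤ 24 * (T * N) := by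
    have h1 := half_log_le_log_div hκ (hε n) hε₂
    have h2 : Real.log (Δ / (1024 * (S : ℝ) ^ 2) / ε n) ≤ 12 * (T * N) / n := by
      rw [Real.log_le_iff_le_exp (div_pos hκ (hε n)), div_le_iff₀' (hε n)]
      rwa [Real.exp_neg, ← div_eq_mul_inv, div_le_iff₀ (Real.exp_pos _)] at hctx
    have h3 := h1.trans h2
    rw [le_div_iff₀ hn0] at h3
    linarith
  have hTN : (0 : ℝ) ≤ T * N := by positivity
  push_cast
  have hT : (0 : ℝ) ≤ T := by positivity
  nlinarith
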